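/- Let $q$ be a prime power and let $\mathrm{GF}(q)\subset \mathrm{GF}(q^3)$. Fix a $\mathrm{GF}(q)$-basis of $\mathrm{GF}(q^3)$ (for example $1,\tau,\tau^2$) and write $\sigma(\alpha)\in \mathrm{GF}(q)^3$ for the coordinates of $\alpha\in \mathrm{GF}(q^3)$. Let $\ell_\infty$ be the line $z=0$ of $\mathrm{PG}(2,q^3)$ and $\Sigma_\infty$ the hyperplane $z=0$ of $\mathrm{PG}(6,q)$, whose points have coordinates $(x_0,x_1,x_2,y_0,y_1,y_2,z)$. For a point $X=(\alpha,\beta,0)$ of $\ell_\infty$ let $[X]=\{(\sigma(\lambda\alpha),\sigma(\lambda\beta),0) : \lambda\in \mathrm{GF}(q^3)\}$, a plane of $\Sigma_\infty$; these planes form a regular spread $\mathcal S$. A transversal of $\mathcal S$ is a line $g$ of $\mathrm{PG}(6,q^3)$ in the extension of $\Sigma_\infty$, disjoint from $\mathrm{PG}(6,q)$, such that the elements of $\mathcal S$ are the intersections of $\mathrm{PG}(6,q)$ with the planes $\langle P,P^q,P^{q^2}\rangle$, $P\in g$. Write $\mathcal K^*$ for the extension of a curve or ruled surface $\mathcal K$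 of $\mathrm{PG}(6,q)$ to $\mathrm{PG}(6,q^3)$. Let $\mathscr B$ be a subplane of order $q$ of $\mathrm{PG}(2,q^3)$ that meets $\ell_\infty$ in exactly one point $T$ and let its tangent splash $\mathscr S_T$, with centre $T$, be the set of points of $\ell_\infty$ on extended lines of $\mathscr B$. A cover plane of $\mathscr S_T$ is a plane of $\Sigma_\infty$ that meets every plane $[X]$, $X\in\mathscr S_T$, and meets $[T]$ in a line. A special conic in $[T]$ is a non-degenerate conic $\mathcal C$ in $[T]$ such that $\mathcal C^*$ meets the transversals of $\mathcal S$. A special twisted cubic about $[L]$ is a twisted cubic $\mathcal N$ in a 3-space of $\mathrm{PG}(6,q)$ that contains $[L]$ and is not contained in $\Sigma_\infty$, such that $\mathcal N^*$ meets the transversals of $\mathcal S$. All curves carry their parametrisation by $\mathrm{PG}(1,q)$ up to $\mathrm{PGL}(2,q)$, and a projectivity between two of them is a map that is given by an element of $\mathrm{PGL}(2,q)$ on the parameters. **Theorem.** Let $L\in\mathscr S_T\setminus\{T\}$ and let $\mathcal N$ be a special twisted cubic about $[L]$, with points $N_1,\dots,N_{q+1}$. Then: 1. The tangent to $\mathcal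 N$ at $N_i$ meets $[L]$ in exactly one point $D_i$, and exactly one cover plane of $\mathscr S_T$ passes through $D_i$. It meets $[T]$ in a line $t_i$. 2. There is exactly one special conic $\mathcal C$ in $[T]$ such that each of $t_1,\dots,t_{q+1}$ is a tangent of $\mathcal C$ (unique in the sense that $\mathcal C^*$ is determined as a set of points). The map $\phi:\mathcal N\to\mathcal C$ that takes $N_i$ to the unique point $C_i$ of $t_i\cap\mathcal C$ is well defined. 3. There is exactly one projectivity $\eta:\mathcal N\to\mathcal C$ such that the ruled surface $\mathcal V$, whose generators are the lines joining the points of $\mathcal N$ to their images under $\eta$, has an extension $\mathcal V^*$ that contains the transversals of $\mathcal S$. Moreover $\phi=\eta$. In particular $\phi$ is a projectivity, and the lines $N_iC_i$, $i=1,\dots,q+1$, are the generators of $\mathcal V$. -/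

import Mathlib

open scoped LinearAlgebra.Projectivization MatrixGroups

namespace TangentSplash

noncomputable section

/-! ### Projective spaces `PG(6,q)`, `PG(6,q³)` and `PG(2,q³)`

`K = GF(q)`, `F = GF(q³)`. Points of a projective space are elements of `ℙ R M`, its other
subspaces are submodules of `M`; a line, plane, 3-space has `finrank` 2, 3, 4. -/

/-- Homogeneous coordinates `(x₀,x₁,x₂,y₀,y₁,y₂,z)` over `R`: the vector space of `PG(6,R)`. -/
abbrev V7 (R : Type*) : Type _ := (Fin 3 → R) × (Fin 3 → R) × R

/-- The hyperplane at infinity `Σ∞ : z = 0` of `PG(6,R)`. -/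
def sigmaInf (R : Type*) [Field R] : Submodule R (V7 R) :=
  LinearMap.ker ((LinearMap.snd R (Fin 3 → R) R).comp (LinearMap.snd R (Fin 3 → R) _))

/-- The line at infinity `ℓ∞ : z = 0` of `PG(2,F)`. -/
def lineInf (F : Type*) [Field F] : Submodule F (F × F × F) :=
  LinearMap.ker ((LinearMap.snd F F F).comp (LinearMap.snd F F _))

section Extension

variable (K F : Type*) [Field K] [Field F] [Algebra K F]

/-- The natural embedding of `PG(6,q)` in its cubic extension `PG(6,q³)`, on vectors. -/
def ext : V7 K →ₗ[K] V7 F :=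
  LinearMap.prodMap ((Algebra.linearMap K F).compLeft (Fin 3))
    (LinearMap.prodMap ((Algebra.linearMap K F).compLeft (Fin 3)) (Algebra.linearMap K F))

variable {F} in
/-- The conjugation `P ↦ P^q` of `PG(6,q³)`, on vectors: all coordinates are raised to the power
`q = |K|`. -/
def conj (v : V7 F) : V7 F :=
  (fun i => v.1 i ^ Nat.card K, fun i => v.2.1 i ^ Nat.card K, v.2.2 ^ Nat.card K)

end Extension

section BruckBose

variable {K F : Type*} [Field K] [Field F] [Algebra K F]

/-- The inverse of the (generalised) Bruck-Bose map `σ`: the vector `(x₀,x₁,x₂,y₀,y₁,y₂,z)` over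
`K` is sent to `(∑ xᵢ bᵢ, ∑ yᵢ bᵢ, z)`. -/
def sigmaInv (b : Module.Basis (Fin 3) K F) : V7 K →ₗ[K] F × F × F :=
  LinearMap.prodMap b.equivFun.symm.toLinearMap
    (LinearMap.prodMap b.equivFun.symm.toLinearMap (Algebra.linearMap K F))

/-- The subspace `[X]` of `PG(6,q)` that corresponds to a point `X` of `PG(2,q³)`. For `X` on `ℓ∞`
it is an element of the regular spread. -/
def bb (b : Module.Basis (Fin 3) K F) (X : ℙ F (F × F × F)) : Submodule K (V7 K) :=
  (X.submodule.restrictScalars K).comap (sigmaInv b)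

/-- The regular 2-spread `𝒮` of `Σ∞`. -/
def spread (b : Module.Basis (Fin 3) K F) : Set (Submodule K (V7 K)) :=
  {W | ∃ X : ℙ F (F × F × F), X.submodule ≤ lineInf F ∧ W = bb b X}

/-- `g` is a transversal line of the spread: a line of `Σ∞` over `GF(q³)`, disjoint from `PG(6,q)`,
such that the spread elements are the intersections of the planes `⟨P, P^q, P^{q²}⟩`, `P ∈ g`, with
`PG(6,q)`. -/
def IsTransversal (b : Module.Basis (Fin 3) K F) (g : Submodule F (V7 F)) : Prop :=
  Module.finrank F g = 2 ∧ g ≤ sigmaInf F ∧ (∀ v : V7 K, ext K F v ∈ g → v = 0) ∧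
  {W | ∃ p ∈ g, p ≠ 0 ∧
    W = ((Submodule.span F {p, conj K p, conj K (conj K p)}).restrictScalars K).comap (ext K F)}
    = spread b

/-! ### Order-`q`-subplanes, tangent splashes and cover planes -/

/-- The order-`q`-subplane with frame `e`: the points whose coordinates with respect to the basis
`e` can be taken in `K`. These are the images of `PG(2,q)` under `PGL(3,q³)`. -/
def subplane (K : Type*) {F : Type*} [Field K] [Field F] [Algebra K F]
    (e : Module.Basis (Fin 3) F (F × F × F)) : Set (ℙ F (F × F × F)) :=
  {P | ∃ k : Fin 3 → K, ∑ i, algebraMap K F (k i) • e i ≠ 0 ∧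
    ∑ i, algebraMap K F (k i) • e i ∈ P.submodule}

/-- `S` is a tangent splash with centre `T`: for some order-`q`-subplane that meets `ℓ∞` in exactly
the point `T`, it is the set of points of `ℓ∞` on the (extended) lines of the subplane. -/
def IsTangentSplash (K : Type*) {F : Type*} [Field K] [Field F] [Algebra K F]
    (S : Set (ℙ F (F × F × F))) (T : ℙ F (F × F × F)) : Prop :=
  ∃ e : Module.Basis (Fin 3) F (F × F × F),
    {P ∈ subplane K e | P.submodule ≤ lineInf F} = {T} ∧
    S = {X | X.submodule ≤ lineInf F ∧
      ∃ P ∈ subplane K e, ∃ Q ∈ subplane K e, P ≠ Q ∧ X.submodule ≤ P.submodule ⊔ Q.submodule}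

/-- `π` is a cover plane of the tangent splash `S` with centre `T`: a plane of `Σ∞` that meets
every plane `[X]`, `X ∈ S`, and meets `[T]` in a line. -/
def IsCoverPlane (b : Module.Basis (Fin 3) K F) (S : Set (ℙ F (F × F × F))) (T : ℙ F (F × F × F))
    (π : Submodule K (V7 K)) : Prop :=
  π ≤ sigmaInf K ∧ Module.finrank K π = 3 ∧ (∀ X ∈ S, π ⊓ bb b X ≠ ⊥) ∧
    Module.finrank K ↥(π ⊓ bb b T) = 2

end BruckBose

/-! ### Conics and twisted cubics -/

/-- A rational normal curve of degree `n` with a parametrisation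
`(s,t) ↦ ∑ᵢ sⁿ⁻ⁱ tⁱ aᵢ`, `a₀,…,aₙ` linearly independent, that is the image of
`(sⁿ, sⁿ⁻¹t, …, tⁿ)` under a homography. It is a (non-degenerate) conic of the plane
`⟨a₀,a₁,a₂⟩` for `n = 2` and a twisted cubic of the 3-space `⟨a₀,a₁,a₂,a₃⟩` for `n = 3`. -/
structure NormalCurve (R M : Type*) [Field R] [AddCommGroup M] [Module R M] (n : ℕ) where
  frame : Fin (n + 1) → M
  indep : LinearIndependent R frame

namespace NormalCurve

variable {R M : Type*} [Field R] [AddCommGroup M] [Module R M] {n : ℕ}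

/-- The vector `∑ᵢ sⁿ⁻ⁱ tⁱ aᵢ`, where `p = (s,t)`. -/
def vec (N : NormalCurve R M n) (p : Fin 2 → R) : M :=
  ∑ i : Fin (n + 1), (p 0 ^ (n - (i : ℕ)) * p 1 ^ (i : ℕ)) • N.frame i

/-- The derivative of `vec` at `p = (s,t)` in the direction `u`. -/
def dvec (N : NormalCurve R M n) (p u : Fin 2 → R) : M :=
  ∑ i : Fin (n + 1),
    (u 0 * (((n - (i : ℕ) : ℕ) : R) * p 0 ^ (n - (i : ℕ) - 1) * p 1 ^ (i : ℕ)) +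
      u 1 * (((i : ℕ) : R) * p 0 ^ (n - (i : ℕ)) * p 1 ^ ((i : ℕ) - 1))) • N.frame i

theorem vec_ne_zero (N : NormalCurve R M n) {p : Fin 2 → R} (hp : p ≠ 0) : N.vec p ≠ 0 := by
  intro h
  have h0 := Fintype.linearIndependent_iff.1 N.indep _ h
  apply hp
  have h1 : p 1 ^ n = 0 := by simpa using h0 (Fin.last n)
  have h2 : p 0 ^ n = 0 := by simpa using h0 0
  funext i
  fin_cases i
  · exact eq_zero_of_pow_eq_zero h2
  · exact eq_zero_of_pow_eq_zero h1

theorem vec_smul (N : NormalCurve R M n) (c : R) (p : Fin 2 → R) :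
    N.vec (c • p) = c ^ n • N.vec p := by
  unfold vec
  rw [Finset.smul_sum]
  refine Finset.sum_congr rfl fun i _ => ?_
  rw [smul_smul]
  congr 1
  have h : c ^ n = c ^ (n - (i : ℕ)) * c ^ (i : ℕ) := by
    rw [← pow_add]
    congr 1
    omega
  rw [h]
  simp only [Pi.smul_apply, smul_eq_mul, mul_pow]
  ring

/-- The point of the curve with parameter `x ∈ PG(1,R)`. -/
def point (N : NormalCurve R M n) : ℙ R (Fin 2 → R) → ℙ R M :=
  Projectivization.lift (fun p => Projectivization.mk R (N.vec p.1) (N.vec_ne_zero p.2)) (by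
    rintro ⟨p, hp⟩ ⟨p', hp'⟩ c h
    simp only at h
    rw [Projectivization.mk_eq_mk_iff']
    exact ⟨c ^ n, by rw [← N.vec_smul, ← h]⟩)

/-- The set of points of the curve. -/
def points (N : NormalCurve R M n) : Set (ℙ R M) := Set.range N.point

/-- The tangent line of the curve at the point with parameter `x`. -/
def tangentLine (N : NormalCurve R M n) (x : ℙ R (Fin 2 → R)) : Submodule R M :=
  Submodule.span R (insert (N.vec x.rep) (Set.range (N.dvec x.rep)))

end NormalCurve

section Special

variable {K F : Type*} [Field K] [Field F] [Algebra K F]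

theorem linearIndependent_ext (b : Module.Basis (Fin 3) K F) {n : ℕ} {a : Fin n → V7 K}
    (ha : LinearIndependent K a) : LinearIndependent F (fun i => ext K F (a i)) := by
  rw [Fintype.linearIndependent_iff] at ha ⊢
  intro c hc i
  apply b.ext_elem
  intro j
  have key : ∑ i, b.repr (c i) j • a i = 0 := by
    have coordmul : ∀ (x : F) (k : K), b.repr (x * algebraMap K F k) j = b.repr x j * k := by
      intro x k
      rw [mul_comm, ← Algebra.smul_def]
      simp [mul_comm]
    have h1 := fun l => congrArg (fun y => b.repr y j) (congrFun (congrArg Prod.fst hc) l)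
    have h2 := fun l =>
      congrArg (fun y => b.repr y j) (congrFun (congrArg (fun v => v.2.1) hc) l)
    have h3 := congrArg (fun y => b.repr y j) (congrArg (fun v => v.2.2) hc)
    simp only [Prod.fst_sum, Prod.snd_sum, Finset.sum_apply, Prod.smul_fst, Prod.smul_snd,
      Pi.smul_apply, smul_eq_mul, ext, LinearMap.prodMap_apply, LinearMap.compLeft_apply,
      Function.comp, Algebra.linearMap_apply, map_sum, Finsupp.coe_finsetSum, coordmul,
      Prod.fst_zero, Prod.snd_zero, Pi.zero_apply, map_zero, Finsupp.coe_zero] at h1 h2 h3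
    refine Prod.ext ?_ (Prod.ext ?_ ?_)
    · funext l
      simpa [Prod.fst_sum, Finset.sum_apply] using h1 l
    · funext l
      simpa [Prod.fst_sum, Prod.snd_sum, Finset.sum_apply] using h2 l
    · simpa [Prod.snd_sum] using h3
  rw [ha _ key i]
  simp

/-- The extension `𝒦*` of a curve `𝒦` of `PG(6,q)` to `PG(6,q³)`. -/
def NormalCurve.extend (b : Module.Basis (Fin 3) K F) {n : ℕ} (N : NormalCurve K (V7 K) n) :
    NormalCurve F (V7 F) n where
  frame i := ext K F (N.frame i)
  indep := linearIndependent_ext b N.indep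

/-- The extension of the curve to `PG(6,q³)` meets the transversals of the spread. -/
def MeetsTransversals (b : Module.Basis (Fin 3) K F) {n : ℕ} (N : NormalCurve K (V7 K) n) : Prop :=
  ∀ g, IsTransversal b g → ∃ P ∈ (N.extend b).points, P.submodule ≤ g

/-- A special conic in the spread element `[T]`. -/
def IsSpecialConic (b : Module.Basis (Fin 3) K F) (T : ℙ F (F × F × F))
    (C : NormalCurve K (V7 K) 2) : Prop :=
  (∀ i, C.frame i ∈ bb b T) ∧ MeetsTransversals b C

/-- A special twisted cubic in a 3-space of `PG(6,q)∖Σ∞` about the spread element `[L]`. -/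
def IsSpecialTwistedCubic (b : Module.Basis (Fin 3) K F) (L : ℙ F (F × F × F))
    (N : NormalCurve K (V7 K) 3) : Prop :=
  bb b L ≤ Submodule.span K (Set.range N.frame) ∧
  ¬ Submodule.span K (Set.range N.frame) ≤ sigmaInf K ∧ MeetsTransversals b N

/-! ### The map `φ` -/

/-- `D` is the shadow point of the point of `N` with parameter `x`: the intersection of the tangent
of `N` at this point with `[L]`. -/
def IsShadowPoint (b : Module.Basis (Fin 3) K F) (L : ℙ F (F × F × F))
    (N : NormalCurve K (V7 K) 3) (x : ℙ K (Fin 2 → K)) (D : ℙ K (V7 K)) : Prop :=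
  D.submodule = N.tangentLine x ⊓ bb b L

/-- `t` is the line of `[T]` that corresponds to the point `D` under the cover plane map: the
intersection of `[T]` with a cover plane through `D`. -/
def IsCoverLine (b : Module.Basis (Fin 3) K F) (S : Set (ℙ F (F × F × F))) (T : ℙ F (F × F × F))
    (D : ℙ K (V7 K)) (t : Submodule K (V7 K)) : Prop :=
  ∃ π, IsCoverPlane b S T π ∧ D.submodule ≤ π ∧ t = π ⊓ bb b T

/-- `C` is a special conic in `[T]` constructed from `N`: the lines `tᵢ` that correspond to the
shadow points of `N` are tangents of `C`. -/
def IsConstructedConic (b : Module.Basis (Fin 3) K F) (S : Set (ℙ F (F × F × F)))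
    (T L : ℙ F (F × F × F)) (N : NormalCurve K (V7 K) 3) (C : NormalCurve K (V7 K) 2) : Prop :=
  IsSpecialConic b T C ∧
  ∀ x D t, IsShadowPoint b L N x D → IsCoverLine b S T D t → ∃ y, t = C.tangentLine y

/-- `Q` is the image of the point `P ∈ N` under `φ`: map `P` to its shadow point `D`, then to the
line `t` of `[T]`, then to the point `Q` of `t ∩ C`. -/
def PhiRel (b : Module.Basis (Fin 3) K F) (S : Set (ℙ F (F × F × F)))
    (T L : ℙ F (F × F × F)) (N : NormalCurve K (V7 K) 3) (C : NormalCurve K (V7 K) 2)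
    (P Q : ℙ K (V7 K)) : Prop :=
  ∃ x D t, P = N.point x ∧ IsShadowPoint b L N x D ∧ IsCoverLine b S T D t ∧
    Q ∈ C.points ∧ Q.submodule ≤ t

end Special

/-! ### Ruled surfaces -/

section Ruled

variable {R M : Type*} [Field R] [AddCommGroup M] [Module R M]

/-- The generator line through the point of `N` with parameter `x` of the ruled surface with
directrices `N`, `C` defined by the projectivity from `N` to `C` that maps the point of `N` with
parameter `x` to the point of `C` with parameter `A x`. -/
def generator (N : NormalCurve R M 3) (C : NormalCurve R M 2) (A : GL (Fin 2) R)
    (x : ℙ R (Fin 2 → R)) : Submodule R M :=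
  (N.point x).submodule ⊔ (C.point (A • x)).submodule

/-- The points of this ruled surface. -/
def ruledSurface (N : NormalCurve R M 3) (C : NormalCurve R M 2) (A : GL (Fin 2) R) :
    Set (ℙ R M) :=
  {P | ∃ x, P.submodule ≤ generator N C A x}

/-- The extension `𝒱*` to `PG(6,q³)` of the ruled surface `𝒱` defined by `A` contains the
transversals of the spread. -/
def RuledSurfaceContainsTransversals {K F : Type*} [Field K] [Field F] [Algebra K F]
    (b : Module.Basis (Fin 3) K F) (N : NormalCurve K (V7 K) 3) (C : NormalCurve K (V7 K) 2)
    (A : GL (Fin 2) K) : Prop :=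
  ∀ g, IsTransversal b g → ∀ P : ℙ F (V7 F), P.submodule ≤ g →
    P ∈ ruledSurface (N.extend b) (C.extend b)
      (Matrix.GeneralLinearGroup.map (algebraMap K F) A)

end Ruled

end

end TangentSplash

open TangentSplash

/-! Points of `Σ∞` are written `σ(c x)` with `x` a vector of `ℓ∞` and `c ∈ F`. Let `l` and `t` be
vectors of `L` and `T`. All objects then become `K`-subspaces of `F` and reciprocals of linear forms
on `K²`, and the theorem becomes a computation with these.

The splash consists of `T` and the points `⟨l + w t⟩`, with `w` in a two-dimensional `K`-subspace
`W` of `F` (`IsTangentSplash.exists_coordinates`). The only cover plane through `σ(d l)` cuts `[T]`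
in `σ(d W t)` (`IsCoverPlane.eq_coverPlane`).

Over `F` the spread has exactly three transversals, permuted by conjugation, and each is the common
kernel of two of three conjugate coordinate maps (`IsTransversal.exists_eq`). A curve meeting them
has a parametrisation that vanishes at prescribed conjugates of one parameter. Up to a scalar, a
special conic is therefore `σ((ρ / f) t)` and a special cubic is `A + σ((g / e) l)`. Here `f` and
`e` are the forms with roots `φ` and `θ` outside `K`, and `g` is a linear form with coefficients
`l₀, l₁` in `F`.

Differentiation gives the tangents of the conic as `σ((ρ / f²)⟨1, φ⟩ t)`. The tangent of the cubic
meets `[L]` in `σ((μ / e²) l)`, where `μ = l₀ θ + l₁`, so the lines in `[T]` are `σ((μ / e²) W t)`.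
Any two planes of `F` over `K` differ by a factor, so `W = κ⟨1, θ⟩`, and the conic with `φ = θ`, `ρ
= μ κ` has these lines as tangents, with matching parameters.

For uniqueness, let another conic have the same tangents. Its plane `⟨1, φ⟩` is `ν⟨1, θ⟩`, which
gives a `B ∈ GL(2, K)` with `f ∘ B = ν e`. The tangency conditions determine `ρ / (μ κ ν)` only
through squares of elements of the plane, and `mem_range_of_mul_sq` shows that this is enough to put
it in `K` (`exists_matching`). So the conic is the first one reparametrised by `B`.

The ruled surface of a projectivity contains the transversals exactly if the projectivity sends `θ`
to `φ` (`ruledSurfaceContainsTransversals_iff`). An element of `PGL(2, K)` is determined by the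
image of one `θ` of degree three (`mk_eq_mk_iff_fixes`), and `B` has this property. Hence the map
given by tangents and the projectivity given by transversals coincide. -/

open scoped Pointwise

namespace TangentSplash

/-! ### Arithmetic of the cubic extension: conjugates, norms, squares and planes of `F` over `K`. -/

section CubicField

variable (K F : Type*) [Field K] [Finite K] [Field F] [Algebra K F]

/-- The Frobenius map `x ↦ x ^ |K|` as a `K`-algebra endomorphism. -/
noncomputable def frob : F →ₐ[K] F :=
  letI := Fintype.ofFinite K
  FiniteField.frobeniusAlgHom K F

variable {K F}

theorem frob_apply (x : F) : frob K F x = x ^ Nat.card K := by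
  let _ := Fintype.ofFinite K
  rw [Nat.card_eq_fintype_card]
  rfl

theorem frob_injective : Function.Injective (frob K F) := (frob K F).injective

omit [Finite K] in
theorem finrank_smul_submodule {W : Submodule K F} {ν : F} (hν : ν ≠ 0) :
    Module.finrank K ↥(ν • W) = Module.finrank K W := by
  have e : ν • W = W.map (LinearMap.mulLeft K ν) := by
    ext x
    simp [Submodule.mem_smul_pointwise_iff_exists]
  rw [e]
  exact (Submodule.equivMapOfInjective _ (mul_right_injective₀ hν) W).finrank_eq.symm

variable (h3 : Module.finrank K F = 3)
include h3

theorem frob_frob_frob (x : F) : frob K F (frob K F (frob K F x)) = x := by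
  let _ := Fintype.ofFinite K
  have : FiniteDimensional K F := FiniteDimensional.of_finrank_pos (by omega)
  have : Finite F := Module.finite_of_finite K
  have h := FiniteField.orderOf_frobeniusAlgHom K F
  have h' : frob K F ^ 3 = 1 := by
    rw [← h3, ← h]
    exact pow_orderOf_eq_one _
  exact DFunLike.congr_fun h' x

theorem mem_range_of_frob_eq {x : F} (hx : frob K F x = x) : x ∈ Set.range (algebraMap K F) := by
  let _ := Fintype.ofFinite K
  have : FiniteDimensional K F := FiniteDimensional.of_finrank_pos (by omega)
  have : Finite F := Module.finite_of_finite K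
  have : IsGalois K F := inferInstance
  refine (IsGalois.mem_range_algebraMap_iff_fixed x).2 fun f => ?_
  obtain ⟨n, hn⟩ := (FiniteField.bijective_frobeniusAlgHom_pow K F).2 (f : F →ₐ[K] F)
  have h1 : ∀ n : ℕ, (frob K F ^ n) x = x := by
    intro n
    induction n with
    | zero => rfl
    | succ n ih => rw [pow_succ, AlgHom.mul_apply, hx, ih]
  have := DFunLike.congr_fun hn x
  exact this.symm.trans (h1 n)

theorem norm_mem_range (x : F) :
    x * frob K F x * frob K F (frob K F x) ∈ Set.range (algebraMap K F) := by
  apply mem_range_of_frob_eq h3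
  rw [map_mul, map_mul, frob_frob_frob h3]
  ring

theorem frob_ne {θ : F} (hθ : θ ∉ Set.range (algebraMap K F)) : frob K F θ ≠ θ :=
  fun h => hθ (mem_range_of_frob_eq h3 h)

theorem frob_frob_ne {θ : F} (hθ : θ ∉ Set.range (algebraMap K F)) :
    frob K F (frob K F θ) ≠ θ := by
  intro h
  apply frob_ne h3 hθ
  have := congrArg (frob K F) h
  rw [frob_frob_frob h3] at this
  exact this.symm

/-- The polynomial has coefficients in `K`, so it vanishes at all three conjugates of `θ`. These are
distinct, and divided differences kill the coefficients one by one. -/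
theorem quadratic_coeffs_eq_zero {θ : F} (hθ : θ ∉ Set.range (algebraMap K F)) {a b c : K}
    (h : algebraMap K F a + algebraMap K F b * θ + algebraMap K F c * θ ^ 2 = 0) :
    a = 0 ∧ b = 0 ∧ c = 0 := by
  have h' := congrArg (frob K F) h
  have h'' := congrArg (frob K F) h'
  simp only [map_add, map_mul, map_pow, AlgHom.commutes, map_zero] at h' h''
  have n1 := sub_ne_zero.2 (frob_ne h3 hθ)
  have n2 := sub_ne_zero.2 (frob_frob_ne h3 hθ)
  have n3 : frob K F (frob K F θ) - frob K F θ ≠ 0 :=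
    sub_ne_zero.2 fun h => frob_ne h3 hθ (frob_injective h)
  set x := θ
  set y := frob K F x
  set z := frob K F y
  have e1 : algebraMap K F b + algebraMap K F c * (x + y) = 0 := by
    apply mul_left_cancel₀ n1
    linear_combination h' - h
  have e2 : algebraMap K F b + algebraMap K F c * (x + z) = 0 := by
    apply mul_left_cancel₀ n2
    linear_combination h'' - h
  have hc : algebraMap K F c = 0 := by
    apply mul_left_cancel₀ n3
    linear_combination e2 - e1
  have hb : algebraMap K F b = 0 := by simpa [hc] using e1
  have ha : algebraMap K F a = 0 := by simpa [hc, hb] using h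
  exact ⟨by simpa using ha, by simpa using hb, by simpa using hc⟩

theorem linear_coeffs_eq_zero {θ : F} (hθ : θ ∉ Set.range (algebraMap K F)) {a b : K}
    (h : algebraMap K F a - θ * algebraMap K F b = 0) : a = 0 ∧ b = 0 := by
  have := quadratic_coeffs_eq_zero h3 hθ (a := a) (b := -b) (c := 0)
    (by rw [map_neg, map_zero]; linear_combination h)
  exact ⟨this.1, by simpa using this.2.1⟩

/-- Otherwise `w`, `γ w`, `γ² w` would be three independent vectors of the plane `W`. -/
theorem mem_range_of_smul_le {W : Submodule K F} (hW : Module.finrank K W = 2) {γ : F}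
    (h : ∀ w ∈ W, γ * w ∈ W) : γ ∈ Set.range (algebraMap K F) := by
  by_contra hγ
  have : FiniteDimensional K F := FiniteDimensional.of_finrank_pos (by omega)
  obtain ⟨w, hw, hw0⟩ := W.exists_mem_ne_zero_of_ne_bot (by rintro rfl; simp at hW)
  have hli : LinearIndependent K ![w, γ * w, γ * (γ * w)] := by
    rw [Fintype.linearIndependent_iff]
    intro g hg
    simp only [Fin.sum_univ_three, Matrix.cons_val, Algebra.smul_def] at hg
    have := quadratic_coeffs_eq_zero h3 hγ (a := g 0) (b := g 1) (c := g 2) (by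
      apply mul_right_cancel₀ hw0
      linear_combination hg)
    intro i
    fin_cases i
    exacts [this.1, this.2.1, this.2.2]
  have hle : Submodule.span K (Set.range ![w, γ * w, γ * (γ * w)]) ≤ W := by
    rw [Submodule.span_le]
    rintro _ ⟨i, rfl⟩
    fin_cases i
    exacts [hw, h _ hw, h _ (h _ hw)]
  have := Submodule.finrank_mono hle
  rw [finrank_span_eq_card hli, hW] at this
  simp at this

/-- `W'` is the kernel of a functional, and `ν W ≤ W'` imposes two linear conditions on `ν` in the
three-dimensional space `F`, so a nonzero solution exists. -/
theorem exists_smul_eq {W W' : Submodule K F} (hW : Module.finrank K W = 2)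
    (hW' : Module.finrank K W' = 2) : ∃ ν : F, ν ≠ 0 ∧ W' = ν • W := by
  have : FiniteDimensional K F := FiniteDimensional.of_finrank_pos (by omega)
  obtain ⟨f, hf0, hf⟩ := Submodule.exists_le_ker_of_lt_top W'
    (lt_top_iff_ne_top.2 fun h => by rw [h, finrank_top] at hW'; omega)
  have hW'f : W' = LinearMap.ker f := by
    apply Submodule.eq_of_le_of_finrank_eq hf
    have h1 := LinearMap.finrank_range_add_finrank_ker f
    have h2 : Module.finrank K (LinearMap.range f) = 1 := by
      rw [LinearMap.range_eq_top.2 (LinearMap.surjective hf0), finrank_top, Module.finrank_self]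
    omega
  let B := Module.finBasisOfFinrankEq K W hW
  let G : F →ₗ[K] (Fin 2 → K) :=
    LinearMap.pi fun i => f.comp (LinearMap.mulRight K ((B i : W) : F))
  have hG : LinearMap.ker G ≠ ⊥ := by
    intro h
    have := LinearMap.finrank_le_finrank_of_injective (LinearMap.ker_eq_bot.1 h)
    rw [h3, Module.finrank_fin_fun] at this
    omega
  obtain ⟨ν, hν, hν0⟩ := Submodule.exists_mem_ne_zero_of_ne_bot hG
  refine ⟨ν, hν0, ?_⟩
  symm
  apply Submodule.eq_of_le_of_finrank_eq
  · intro x hx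
    obtain ⟨w, hw, rfl⟩ := (Submodule.mem_smul_pointwise_iff_exists _ _ _).1 hx
    rw [hW'f, LinearMap.mem_ker]
    have e : ((∑ i, B.repr ⟨w, hw⟩ i • B i : W) : F) = w := by rw [B.sum_repr]
    have hi : ∀ i, f (ν * (B i : F)) = 0 := fun i => congrFun (LinearMap.mem_ker.1 hν) i
    rw [smul_eq_mul, ← e, Fin.sum_univ_two, Submodule.coe_add, Submodule.coe_smul,
      Submodule.coe_smul, mul_add, mul_smul_comm, mul_smul_comm, map_add, map_smul, map_smul,
      hi, hi]
    simp
  · rw [finrank_smul_submodule hν0, hW, hW']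

theorem mem_range_of_sq {x : F} (hx : x ^ 2 ∈ Set.range (algebraMap K F)) :
    x ∈ Set.range (algebraMap K F) := by
  by_contra h
  obtain ⟨k, hk⟩ := hx
  have := quadratic_coeffs_eq_zero h3 h (a := -k) (b := 0) (c := 1) (by
    rw [map_neg, hk]; simp)
  simp at this

/-- The exponent `q + q²` is even, so the norm of `γ` is `γ` times a square. This works in every
characteristic. -/
theorem exists_eq_mul_sq (γ : F) (hγ : γ ≠ 0) :
    ∃ (k : K) (δ : F), δ ≠ 0 ∧ γ = algebraMap K F k * δ ^ 2 := by
  obtain ⟨k, hk⟩ := norm_mem_range h3 γ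
  obtain ⟨r, hr⟩ : ∃ r, Nat.card K + Nat.card K * Nat.card K = 2 * r := by
    obtain ⟨r, hr⟩ := Nat.even_mul_succ_self (Nat.card K)
    exact ⟨r, by rw [Nat.mul_succ] at hr; omega⟩
  refine ⟨k, (γ ^ r)⁻¹, by positivity, ?_⟩
  have e : γ * frob K F γ * frob K F (frob K F γ) = γ * (γ ^ r) ^ 2 := by
    rw [frob_apply, frob_apply, ← pow_mul, ← pow_mul, mul_assoc, ← pow_add, hr, mul_comm r]
  rw [hk, e]
  field_simp

/-- Write `γ = k₀ δ²`. The hypothesis says that `(δ w / w')²` lies in `K`, hence so does `δ w / w'`,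
because the degree is odd. So `δ` maps `W` into itself and lies in `K`. -/
theorem mem_range_of_mul_sq {W : Submodule K F} (hW : Module.finrank K W = 2) {γ : F}
    (h : ∀ w ∈ W, w ≠ 0 → ∃ w' ∈ W, ∃ k : K, w' ≠ 0 ∧ γ * w ^ 2 = algebraMap K F k * w' ^ 2) :
    γ ∈ Set.range (algebraMap K F) := by
  rcases eq_or_ne γ 0 with rfl | hγ
  · exact ⟨0, map_zero _⟩
  obtain ⟨k₀, δ, hδ, e⟩ := exists_eq_mul_sq h3 γ hγ
  have hk₀ : algebraMap K F k₀ ≠ 0 := by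
    rintro h0
    simp [e, h0] at hγ
  have hδK : δ ∈ Set.range (algebraMap K F) := by
    apply mem_range_of_smul_le h3 hW
    intro w hw
    rcases eq_or_ne w 0 with rfl | hw0
    · simp
    obtain ⟨w', hw', k, hw'0, e'⟩ := h w hw hw0
    obtain ⟨c, hc⟩ := mem_range_of_sq h3 (x := δ * w / w') ⟨k / k₀, by
      rw [map_div₀]
      field_simp
      rw [e] at e'
      linear_combination -e'⟩
    have : δ * w = c • w' := by
      rw [Algebra.smul_def, hc]
      field_simp
    rw [this]
    exact W.smul_mem _ hw'
  obtain ⟨d, rfl⟩ := hδK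
  exact ⟨k₀ * d ^ 2, by rw [e, map_mul, map_pow]⟩

end CubicField

/-! ### Spread elements as images of `F`. -/

section SpreadElements

variable {K F : Type*} [Field K] [Field F] [Algebra K F] (b : Module.Basis (Fin 3) K F)

theorem sigmaInv_injective : Function.Injective (sigmaInv b) := by
  intro v w h
  simp only [sigmaInv, LinearMap.prodMap_apply, Prod.mk.injEq] at h
  refine Prod.ext (b.equivFun.symm.injective h.1) (Prod.ext (b.equivFun.symm.injective h.2.1)
    ((algebraMap K F).injective h.2.2))

theorem mem_sigmaInf {R : Type*} [Field R] {v : V7 R} : v ∈ sigmaInf R ↔ v.2.2 = 0 := Iff.rfl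

theorem mem_lineInf {x : F × F × F} : x ∈ lineInf F ↔ x.2.2 = 0 := Iff.rfl

theorem sigmaInv_snd_snd (v : V7 K) : (sigmaInv b v).2.2 = algebraMap K F v.2.2 := rfl

/-- The `K`-linear parametrisation `c ↦ σ(c x)` of the spread element of the point `x` of `ℓ∞`. -/
noncomputable def emb (x : F × F × F) : F →ₗ[K] V7 K :=
  LinearMap.prod (b.equivFun.toLinearMap.comp (LinearMap.mulRight K x.1))
    (LinearMap.prod (b.equivFun.toLinearMap.comp (LinearMap.mulRight K x.2.1)) 0)

theorem emb_snd_snd (x : F × F × F) (c : F) : (emb b x c).2.2 = 0 := rfl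

variable {b}

theorem sigmaInv_emb {x : F × F × F} (hx : x ∈ lineInf F) (c : F) :
    sigmaInv b (emb b x c) = c • x := by
  have h : x.2.2 = 0 := hx
  refine Prod.ext ?_ (Prod.ext ?_ ?_)
  · exact b.equivFun.symm_apply_apply _
  · exact b.equivFun.symm_apply_apply _
  · simp [sigmaInv, emb, h]

theorem emb_injective {x : F × F × F} (hx : x ∈ lineInf F) (hx0 : x ≠ 0) :
    Function.Injective (emb b x) := by
  intro c d h
  have := congrArg (sigmaInv b) h
  rw [sigmaInv_emb hx, sigmaInv_emb hx] at this
  exact smul_left_injective F hx0 this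

theorem mem_bb {x : F × F × F} (hx0 : x ≠ 0) {v : V7 K} :
    v ∈ bb b (Projectivization.mk F x hx0) ↔ ∃ c : F, sigmaInv b v = c • x := by
  simp only [bb, Submodule.mem_comap, Submodule.restrictScalars_mem,
    Projectivization.submodule_mk, Submodule.mem_span_singleton, eq_comm]

theorem emb_mem_bb {x : F × F × F} (hx : x ∈ lineInf F) (hx0 : x ≠ 0) (c : F) :
    emb b x c ∈ bb b (Projectivization.mk F x hx0) :=
  (mem_bb hx0).2 ⟨c, sigmaInv_emb hx c⟩

theorem bb_eq_range {x : F × F × F} (hx : x ∈ lineInf F) (hx0 : x ≠ 0) :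
    bb b (Projectivization.mk F x hx0) = LinearMap.range (emb b x) := by
  ext v
  rw [mem_bb, LinearMap.mem_range]
  refine exists_congr fun c => ?_
  rw [← sigmaInv_emb (b := b) hx, (sigmaInv_injective b).eq_iff, eq_comm]

theorem finrank_bb {x : F × F × F} (hx : x ∈ lineInf F) (hx0 : x ≠ 0) :
    Module.finrank K (bb b (Projectivization.mk F x hx0)) = 3 := by
  rw [bb_eq_range hx, LinearMap.finrank_range_of_inj (emb_injective hx hx0),
    Module.finrank_eq_card_basis b]
  simp

end SpreadElements

/-! ### The three conjugate coordinate maps and the lines on which two of them vanish. -/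

section Coordinates

variable {K F : Type*} [Field K] [Field F] [Algebra K F] (b : Module.Basis (Fin 3) K F)

/-- The componentwise action of an endomorphism of `F` on `F × F × F`. -/
def tri (τ : F →ₐ[K] F) (x : F × F × F) : F × F × F := (τ x.1, τ x.2.1, τ x.2.2)

theorem tri_smul (τ : F →ₐ[K] F) (c : F) (x : F × F × F) : tri τ (c • x) = τ c • tri τ x := by
  simp [tri]

theorem tri_add (τ : F →ₐ[K] F) (x y : F × F × F) : tri τ (x + y) = tri τ x + tri τ y := by
  simp [tri]

theorem tri_eq_zero {τ : F →ₐ[K] F} {x : F × F × F} : tri τ x = 0 ↔ x = 0 := by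
  simp [tri, Prod.ext_iff]

/-- The coordinate map of `V7 F` conjugate to the `F`-linear extension of `sigmaInv b` by `τ`:
it sends `(x, y, z)` to `(∑ xᵢ τ(bᵢ), ∑ yᵢ τ(bᵢ), z)`. -/
noncomputable def th (τ : F →ₐ[K] F) : V7 F →ₗ[F] F × F × F :=
  LinearMap.prodMap (Fintype.linearCombination F fun i => τ (b i))
    (LinearMap.prodMap (Fintype.linearCombination F fun i => τ (b i)) LinearMap.id)

theorem th_apply (τ : F →ₐ[K] F) (v : V7 F) :
    th b τ v = (∑ i, v.1 i * τ (b i), ∑ i, v.2.1 i * τ (b i), v.2.2) := by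
  simp [th, Fintype.linearCombination_apply]

theorem th_ext (τ : F →ₐ[K] F) (v : V7 K) : th b τ (ext K F v) = tri τ (sigmaInv b v) := by
  rw [th_apply]
  simp [ext, tri, sigmaInv, Module.Basis.equivFun_symm_apply, Algebra.smul_def]

theorem exists_notMem_range (h3 : Module.finrank K F = 3) :
    ∃ θ : F, θ ∉ Set.range (algebraMap K F) := by
  by_contra! h
  have h1 : Function.Surjective (Algebra.linearMap K F) := h
  have := LinearMap.range_eq_top.2 h1
  have h2 := LinearMap.finrank_range_le (Algebra.linearMap K F)
  rw [this, finrank_top, h3, Module.finrank_self] at h2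
  omega

theorem algHom_notMem_range (τ : F →ₐ[K] F) {θ : F} (hθ : θ ∉ Set.range (algebraMap K F)) :
    τ θ ∉ Set.range (algebraMap K F) := by
  rintro ⟨k, hk⟩
  apply hθ
  exact ⟨k, τ.injective ((τ.commutes k).trans hk)⟩

theorem finrank_eq_three (b : Module.Basis (Fin 3) K F) : Module.finrank K F = 3 := by
  rw [Module.finrank_eq_card_basis b, Fintype.card_fin]

variable [Finite K]

theorem th_frob_conj (τ : F →ₐ[K] F) (v : V7 F) :
    th b (frob K F * τ) (conj K v) = tri (frob K F) (th b τ v) := by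
  simp only [th_apply, tri, conj, map_sum, map_mul, AlgHom.mul_apply, frob_apply]

theorem map_frob (τ : F →ₐ[K] F) (x : F) : τ (frob K F x) = frob K F (τ x) := by
  rw [frob_apply, frob_apply, map_pow]

/-- The matrix of the conjugates of the basis `b` under `τ`, `τ^q`, `τ^{q²}`. -/
noncomputable def conjMatrix (τ : F →ₐ[K] F) : Matrix (Fin 3) (Fin 3) F :=
  Matrix.of fun j i => (![τ, frob K F * τ, frob K F * (frob K F * τ)] j) (b i)

/-- A relation between the rows is a relation between three distinct embeddings on a basis, hence on
all of `F`, against Dedekind's independence of characters. -/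
theorem conjMatrix_det_ne_zero (τ : F →ₐ[K] F) : (conjMatrix b τ).det ≠ 0 := by
  have h3 := finrank_eq_three b
  intro h
  obtain ⟨c, hc0, hc⟩ := Matrix.exists_vecMul_eq_zero_iff.2 h
  let s : Fin 3 → (F →ₐ[K] F) := ![τ, frob K F * τ, frob K F * (frob K F * τ)]
  have hs : Function.Injective s := by
    obtain ⟨θ, hθ⟩ := exists_notMem_range (K := K) h3
    have hθ' := algHom_notMem_range τ hθ
    have n1 := frob_ne h3 hθ'
    have n2 := frob_frob_ne h3 hθ'
    have n3 : frob K F (frob K F (τ θ)) ≠ frob K F (τ θ) := fun h => n1 (frob_injective h)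
    intro i j hij
    have := DFunLike.congr_fun hij θ
    fin_cases i <;> fin_cases j <;> first | rfl | skip
    exacts [(n1 this.symm).elim, (n2 this.symm).elim, (n1 this).elim, (n3 this.symm).elim,
      (n2 this).elim, (n3 this).elim]
  have hli := (linearIndependent_monoidHom F F).comp (fun j => (s j : F →* F))
    (fun i j hij => hs (AlgHom.ext fun x => DFunLike.congr_fun hij x))
  rw [Fintype.linearIndependent_iff] at hli
  apply hc0
  funext j
  refine hli c ?_ j
  funext x
  have hb : ∑ j, c j • (s j : F →ₐ[K] F).toLinearMap = 0 := by
    refine b.ext fun i => ?_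
    have := congrFun hc i
    simpa [Matrix.vecMul, dotProduct, conjMatrix, s, Fin.sum_univ_three] using this
  have := DFunLike.congr_fun hb x
  simpa using this

/-- The three maps are jointly injective, so identities between vectors over `F` can be checked in
conjugate coordinates. -/
theorem th_eq_zero (τ : F →ₐ[K] F) {v : V7 F} (h0 : th b τ v = 0)
    (h1 : th b (frob K F * τ) v = 0) (h2 : th b (frob K F * (frob K F * τ)) v = 0) : v = 0 := by
  rw [th_apply, Prod.ext_iff, Prod.ext_iff] at h0 h1 h2
  have key : ∀ x : Fin 3 → F, ∑ i, x i * τ (b i) = 0 → ∑ i, x i * (frob K F * τ) (b i) = 0 →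
      ∑ i, x i * (frob K F * (frob K F * τ)) (b i) = 0 → x = 0 := by
    intro x e0 e1 e2
    apply Matrix.eq_zero_of_mulVec_eq_zero (conjMatrix_det_ne_zero b τ)
    funext j
    fin_cases j
    · simpa [conjMatrix, Matrix.mulVec, dotProduct, mul_comm] using e0
    · simpa [conjMatrix, Matrix.mulVec, dotProduct, mul_comm] using e1
    · simpa [conjMatrix, Matrix.mulVec, dotProduct, mul_comm] using e2
  exact Prod.ext (key _ h0.1 h1.1 h2.1) (Prod.ext (key _ h0.2.1 h1.2.1 h2.2.1) h0.2.2)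

/-- The transversal line of the spread on which the coordinate maps other than `th b τ` vanish. -/
noncomputable def transversal (τ : F →ₐ[K] F) : Submodule F (V7 F) :=
  LinearMap.ker (th b (frob K F * τ)) ⊓ LinearMap.ker (th b (frob K F * (frob K F * τ)))

variable {b}

theorem mem_transversal {τ : F →ₐ[K] F} {v : V7 F} : v ∈ transversal b τ ↔
    th b (frob K F * τ) v = 0 ∧ th b (frob K F * (frob K F * τ)) v = 0 := Iff.rfl

theorem snd_snd_of_mem_transversal {τ : F →ₐ[K] F} {v : V7 F} (hv : v ∈ transversal b τ) :
    v.2.2 = 0 := by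
  have := (mem_transversal.1 hv).1
  rw [th_apply] at this
  exact congrArg (fun x => x.2.2) this

theorem exists_mem_transversal (τ : F →ₐ[K] F) {x : F × F × F} (hx : x ∈ lineInf F) :
    ∃ v ∈ transversal b τ, th b τ v = x := by
  have h3 := conjMatrix_det_ne_zero b τ
  -- The first column of the inverse matrix is dual to the conjugates of the basis: `τ` evaluates to
  -- one on it, the other two embeddings to zero.
  let d : Fin 3 → F := (conjMatrix b τ)⁻¹.mulVec ![1, 0, 0]
  have hd : (conjMatrix b τ).mulVec d = ![1, 0, 0] := by
    rw [Matrix.mulVec_mulVec, Matrix.mul_nonsing_inv _ (isUnit_iff_ne_zero.2 h3),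
      Matrix.one_mulVec]
  have e0 : ∑ i, d i * τ (b i) = 1 := by
    simpa [conjMatrix, Matrix.mulVec, dotProduct, mul_comm] using congrFun hd 0
  have e1 : ∑ i, d i * (frob K F * τ) (b i) = 0 := by
    simpa [conjMatrix, Matrix.mulVec, dotProduct, mul_comm] using congrFun hd 1
  have e2 : ∑ i, d i * (frob K F * (frob K F * τ)) (b i) = 0 := by
    simpa [conjMatrix, Matrix.mulVec, dotProduct, mul_comm] using congrFun hd 2
  have hx0 : x.2.2 = 0 := hx
  refine ⟨(x.1 • d, x.2.1 • d, 0), mem_transversal.2 ⟨?_, ?_⟩, ?_⟩ <;> rw [th_apply] <;>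
    simp only [Pi.smul_apply, smul_eq_mul, mul_assoc, ← Finset.mul_sum]
  · rw [e1]; simp
  · rw [e2]; simp
  · rw [e0, mul_one, mul_one, ← hx0]

theorem eq_of_mem_transversal {τ : F →ₐ[K] F} {v w : V7 F} (hv : v ∈ transversal b τ)
    (hw : w ∈ transversal b τ) (h : th b τ v = th b τ w) : v = w := by
  rw [← sub_eq_zero]
  have := mem_transversal.1 (Submodule.sub_mem _ hv hw)
  exact th_eq_zero b τ (by rw [map_sub, h, sub_self]) this.1 this.2

theorem finrank_lineInf : Module.finrank F (lineInf F) = 2 := by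
  have h1 := LinearMap.finrank_range_add_finrank_ker
    ((LinearMap.snd F F F).comp (LinearMap.snd F F (F × F)))
  have h2 : LinearMap.range ((LinearMap.snd F F F).comp (LinearMap.snd F F (F × F))) = ⊤ :=
    LinearMap.range_eq_top.2 fun x => ⟨(0, 0, x), rfl⟩
  rw [h2, finrank_top, Module.finrank_self] at h1
  simp only [Module.finrank_prod, Module.finrank_self] at h1
  change 1 + Module.finrank F (lineInf F) = _ at h1
  omega

omit [Finite K] in
theorem th_mem_lineInf (τ : F →ₐ[K] F) {v : V7 F} (hv : v.2.2 = 0) : th b τ v ∈ lineInf F := by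
  rw [th_apply]
  exact hv

theorem finrank_transversal (τ : F →ₐ[K] F) : Module.finrank F (transversal b τ) = 2 := by
  rw [← finrank_lineInf (F := F)]
  let f : transversal b τ →ₗ[F] lineInf F :=
    ((th b τ).comp (transversal b τ).subtype).codRestrict (lineInf F)
      fun v => th_mem_lineInf τ (snd_snd_of_mem_transversal v.2)
  refine (LinearEquiv.ofBijective f ⟨?_, ?_⟩).finrank_eq
  · intro v w h
    exact Subtype.ext (eq_of_mem_transversal v.2 w.2 (congrArg Subtype.val h))
  · intro x
    obtain ⟨v, hv, e⟩ := exists_mem_transversal (b := b) τ x.2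
    exact ⟨⟨v, hv⟩, Subtype.ext e⟩

end Coordinates

/-! ### Classification of the transversals of the spread. -/

section Transversals

variable {K F : Type*} [Field K] [Finite K] [Field F] [Algebra K F]
  {b : Module.Basis (Fin 3) K F}

theorem frob_mul_frob_mul_frob (h3 : Module.finrank K F = 3) :
    frob K F * (frob K F * frob K F) = 1 :=
  AlgHom.ext fun x => frob_frob_frob h3 x

/-- Conjugation permutes the three lines cyclically, so on each of the three points a different
coordinate map survives. The coordinates of a rational vector are conjugate to each other, so the
first one decides membership, and the coefficients are `c`, `c^q`, `c^{q²}`. -/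
theorem comap_span_conj {p : V7 F} (hp : p ∈ transversal b 1) (hx0 : th b 1 p ≠ 0) :
    ((Submodule.span F {p, conj K p, conj K (conj K p)}).restrictScalars K).comap (ext K F) =
      bb b (Projectivization.mk F (th b 1 p) hx0) := by
  have h3 := finrank_eq_three b
  have hσ := frob_mul_frob_mul_frob h3
  obtain ⟨hp1, hp2⟩ := mem_transversal.1 hp
  rw [mul_one] at hp1 hp2
  have t0 : tri (frob K F) (0 : F × F × F) = 0 := tri_eq_zero.2 rfl
  have q1 : th b (frob K F) (conj K p) = tri (frob K F) (th b 1 p) := by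
    have := th_frob_conj b 1 p
    rwa [mul_one] at this
  have q2 : th b (frob K F * frob K F) (conj K p) = 0 := by
    rw [th_frob_conj, hp1, t0]
  have q0 : th b 1 (conj K p) = 0 := by
    rw [← hσ, th_frob_conj, hp2, t0]
  have r1 : th b (frob K F) (conj K (conj K p)) = 0 := by
    have := th_frob_conj b 1 (conj K p)
    rwa [mul_one, q0, t0] at this
  have r2 : th b (frob K F * frob K F) (conj K (conj K p)) =
      tri (frob K F) (tri (frob K F) (th b 1 p)) := by
    rw [th_frob_conj, q1]
  have r0 : th b 1 (conj K (conj K p)) = 0 := by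
    rw [← hσ, th_frob_conj, q2, t0]
  ext v
  rw [mem_bb, Submodule.mem_comap, Submodule.restrictScalars_mem, Submodule.mem_span_triple]
  constructor
  · rintro ⟨c0, c1, c2, h⟩
    refine ⟨c0, ?_⟩
    have := congrArg (th b 1) h
    rw [map_add, map_add, map_smul, map_smul, map_smul, q0, r0, th_ext] at this
    simpa [tri] using this.symm
  · rintro ⟨c, hc⟩
    refine ⟨c, frob K F c, frob K F (frob K F c), ?_⟩
    rw [← sub_eq_zero]
    apply th_eq_zero b 1 <;>
      simp only [map_add, map_sub, map_smul, mul_one, hp1, hp2, q0, q1, q2, r0, r1, r2, th_ext, hc,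
        tri_smul] <;>
      simp [tri]

variable (b) in
theorem isTransversal_transversal_one : IsTransversal b (transversal b 1) := by
  refine ⟨finrank_transversal 1, fun v hv => mem_sigmaInf.2 (snd_snd_of_mem_transversal hv), ?_, ?_⟩
  · intro v hv
    have := (mem_transversal.1 hv).1
    rw [th_ext, tri_eq_zero] at this
    exact sigmaInv_injective b (this.trans (map_zero _).symm)
  · ext W
    constructor
    · rintro ⟨p, hp, hp0, rfl⟩
      have hx0 : th b 1 p ≠ 0 := fun h =>
        hp0 (eq_of_mem_transversal hp (Submodule.zero_mem _) (by rw [h, map_zero]))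
      refine ⟨Projectivization.mk F _ hx0, ?_, comap_span_conj hp hx0⟩
      rw [Projectivization.submodule_mk, Submodule.span_singleton_le_iff_mem]
      exact th_mem_lineInf _ (snd_snd_of_mem_transversal hp)
    · rintro ⟨X, hX, rfl⟩
      induction X using Projectivization.ind with | _ x hx0 =>
      rw [Projectivization.submodule_mk, Submodule.span_singleton_le_iff_mem] at hX
      obtain ⟨p, hp, rfl⟩ := exists_mem_transversal (b := b) 1 hX
      refine ⟨p, hp, ?_, (comap_span_conj hp hx0).symm⟩
      rintro rfl
      exact hx0 (map_zero _)

-- Three independent vectors of the spread element remain independent over `F` and so span the whole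
-- plane through `p` and its conjugates. On them each coordinate map takes values in the line of the
-- conjugate of `x`.
omit [Finite K] in
theorem th_mem_span_of_comap_eq {p : V7 F} {x : F × F × F} (hx : x ∈ lineInf F) (hx0 : x ≠ 0)
    (h : bb b (Projectivization.mk F x hx0) =
      ((Submodule.span F {p, conj K p, conj K (conj K p)}).restrictScalars K).comap (ext K F))
    (τ : F →ₐ[K] F) : ∃ c : F, th b τ p = c • tri τ x := by
  have h3 := finrank_eq_three b
  let f : Fin 3 → V7 K := fun i => emb b x (b i)
  have hf : LinearIndependent K f := b.linearIndependent.map' _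
    (LinearMap.ker_eq_bot.2 (emb_injective hx hx0))
  have hf' := linearIndependent_ext b hf
  let E := Submodule.span F {p, conj K p, conj K (conj K p)}
  have hle : Submodule.span F (Set.range fun i => ext K F (f i)) ≤ E := by
    rw [Submodule.span_le]
    rintro _ ⟨i, rfl⟩
    have : f i ∈ bb b (Projectivization.mk F x hx0) := emb_mem_bb hx hx0 _
    rw [h] at this
    exact this
  have hE : Module.finrank F E ≤ 3 := by
    classical
    have := finrank_span_finset_le_card (R := F) ({p, conj K p, conj K (conj K p)} : Finset (V7 F))
    simp only [Finset.coe_insert, Finset.coe_singleton] at this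
    exact this.trans Finset.card_le_three
  have hEq : Submodule.span F (Set.range fun i => ext K F (f i)) = E := by
    apply Submodule.eq_of_le_of_finrank_le hle
    rw [finrank_span_eq_card hf', Fintype.card_fin]
    exact hE
  have hp : p ∈ Submodule.span F (Set.range fun i => ext K F (f i)) := by
    rw [hEq]
    exact Submodule.subset_span (by simp)
  have hmap : Submodule.span F (Set.range fun i => ext K F (f i)) ≤
      (Submodule.span F {tri τ x}).comap (th b τ) := by
    rw [Submodule.span_le]
    rintro _ ⟨i, rfl⟩
    change th b τ (ext K F (f i)) ∈ Submodule.span F {tri τ x}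
    rw [th_ext, sigmaInv_emb hx, tri_smul]
    exact Submodule.smul_mem _ _ (Submodule.mem_span_singleton_self _)
  obtain ⟨c, hc⟩ := Submodule.mem_span_singleton.1 (hmap hp)
  exact ⟨c, hc.symm⟩

/-- The only transversals of the spread are the lines `transversal b τ`. -/
theorem IsTransversal.exists_eq {g : Submodule F (V7 F)} (hg : IsTransversal b g) :
    ∃ τ : F →ₐ[K] F, g = transversal b τ := by
  have h3 := finrank_eq_three b
  obtain ⟨hg2, -, -, hgS⟩ := hg
  have key : ∀ x : F × F × F, x ∈ lineInf F → x ≠ 0 →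
      ∃ p ∈ g, p ≠ 0 ∧ ∀ τ : F →ₐ[K] F, ∃ c : F, th b τ p = c • tri τ x := by
    intro x hx hx0
    have : bb b (Projectivization.mk F x hx0) ∈ spread b :=
      ⟨_, by rwa [Projectivization.submodule_mk, Submodule.span_singleton_le_iff_mem], rfl⟩
    rw [← hgS] at this
    obtain ⟨p, hp, hp0, e⟩ := this
    exact ⟨p, hp, hp0, th_mem_span_of_comap_eq hx hx0 e⟩
  obtain ⟨p, hp, hp0, hpa⟩ := key (1, 0, 0) rfl (by simp)
  obtain ⟨q, hq, hq0, hqd⟩ := key (0, 1, 0) rfl (by simp)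
  choose a ha using hpa
  choose d hd using hqd
  simp only [tri, map_one, map_zero, Prod.smul_mk, smul_eq_mul, mul_one, mul_zero] at ha hd
  have hzero : ∀ v : V7 F, (∀ τ : F →ₐ[K] F, th b τ v = 0) → v = 0 := fun v h =>
    th_eq_zero b 1 (h _) (h _) (h _)
  have hli : LinearIndependent F ![p, q] := by
    rw [LinearIndependent.pair_iff]
    intro s t hst
    constructor
    · by_contra hs
      apply hp0
      refine hzero p fun τ => ?_
      have := congrArg (th b τ) hst
      rw [map_add, map_smul, map_smul, ha, hd, map_zero] at this
      have : a τ = 0 := by simpa [hs] using congrArg Prod.fst this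
      rw [ha, this]
      rfl
    · by_contra ht
      apply hq0
      refine hzero q fun τ => ?_
      have := congrArg (th b τ) hst
      rw [map_add, map_smul, map_smul, ha, hd, map_zero] at this
      have : d τ = 0 := by simpa [ht] using congrArg (fun x => x.2.1) this
      rw [hd, this]
      rfl
  have hspan : Submodule.span F {p, q} = g := by
    have : FiniteDimensional F g := FiniteDimensional.of_finrank_pos (by omega)
    apply Submodule.eq_of_le_of_finrank_eq
    · rw [Submodule.span_le]
      rintro _ (rfl | rfl)
      exacts [hp, hq]
    · have := finrank_span_eq_card hli
      rw [Matrix.range_cons_cons_empty, Fintype.card_fin] at this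
      rw [this, hg2]
  -- The point of `g` that belongs to `(1, t, 0)` is a combination `α p + β q`, and `r = β / α`
  -- serves for all `τ` at once.
  have hratio : ∀ t : F, t ≠ 0 → ∃ r : F, r ≠ 0 ∧ ∀ τ : F →ₐ[K] F, r * d τ = τ t * a τ := by
    intro t ht
    obtain ⟨u, hu, hu0, huc⟩ := key (1, t, 0) rfl (by simp)
    rw [← hspan, Submodule.mem_span_pair] at hu
    obtain ⟨α, β, rfl⟩ := hu
    choose c hc using huc
    simp only [map_add, map_smul, ha, hd, tri, map_one, map_zero] at hc
    have hc1 : ∀ τ, α * a τ = c τ := fun τ => by simpa using congrArg Prod.fst (hc τ)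
    have hc2 : ∀ τ, β * d τ = c τ * τ t := fun τ => by
      simpa using congrArg (fun x => x.2.1) (hc τ)
    have htτ : ∀ τ : F →ₐ[K] F, τ t ≠ 0 := fun τ => by simpa using ht
    have hα : α ≠ 0 := by
      rintro rfl
      refine hu0 (hzero _ fun τ => ?_)
      have h0 : c τ = 0 := by rw [← hc1, zero_mul]
      rw [map_add, map_smul, map_smul, ha, hd, hc, h0, zero_smul]
    have hβ : β ≠ 0 := by
      rintro rfl
      refine hu0 (hzero _ fun τ => ?_)
      have h0 : c τ = 0 := by
        have := hc2 τ
        rw [zero_mul] at this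
        exact (mul_eq_zero.1 this.symm).resolve_right (htτ τ)
      rw [map_add, map_smul, map_smul, ha, hd, hc, h0, zero_smul]
    refine ⟨β / α, div_ne_zero hβ hα, fun τ => ?_⟩
    field_simp
    rw [hc2, ← hc1]
    ring
  obtain ⟨τ, hτ⟩ : ∃ τ, a τ ≠ 0 := by
    by_contra! h
    exact hp0 (hzero p fun τ => by rw [ha, h]; rfl)
  obtain ⟨θ, hθ⟩ := exists_notMem_range (K := K) h3
  have hθ0 : θ ≠ 0 := by
    rintro rfl
    exact hθ ⟨0, map_zero _⟩
  obtain ⟨r1, hr1, e1⟩ := hratio 1 one_ne_zero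
  obtain ⟨r, hr, e⟩ := hratio θ hθ0
  simp only [map_one, one_mul] at e1
  -- Comparison of the ratios for `1` and `θ` gives the same image of `θ` under every `τ'` that
  -- survives on `p`. As the conjugates of `θ` are distinct, only one of the three coordinate maps
  -- survives on `g`.
  have hval : ∀ τ', a τ' ≠ 0 → τ' θ = r / r1 := by
    intro τ' h
    have h1 := e1 τ'
    have h2 := e τ'
    apply mul_right_cancel₀ h
    rw [← h2]
    rw [← h1]
    field_simp
  have hother : ∀ τ', τ' θ ≠ τ θ → a τ' = 0 ∧ d τ' = 0 := by
    intro τ' h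
    have h0 : a τ' = 0 := by
      by_contra h0
      exact h ((hval τ' h0).trans (hval τ hτ).symm)
    refine ⟨h0, ?_⟩
    have := e1 τ'
    rw [h0] at this
    exact (mul_eq_zero.1 this).resolve_left hr1
  have hτθ := algHom_notMem_range τ hθ
  obtain ⟨a1, d1⟩ := hother (frob K F * τ) (frob_ne h3 hτθ)
  obtain ⟨a2, d2⟩ := hother (frob K F * (frob K F * τ)) (frob_frob_ne h3 hτθ)
  refine ⟨τ, ?_⟩
  apply Submodule.eq_of_le_of_finrank_eq
  · rw [← hspan, Submodule.span_le]
    rintro _ (rfl | rfl)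
    · exact mem_transversal.2 ⟨by rw [ha, a1]; rfl, by rw [ha, a2]; rfl⟩
    · exact mem_transversal.2 ⟨by rw [hd, d1]; rfl, by rw [hd, d2]; rfl⟩
  · rw [hg2, finrank_transversal]

end Transversals

/-! ### Coordinates for a tangent splash. -/

section Splash

theorem eq_mk_of_mem_submodule {F V : Type*} [Field F] [AddCommGroup V] [Module F V]
    {X : ℙ F V} {v : V} (hv : v ≠ 0) (h : v ∈ X.submodule) : X = Projectivization.mk F v hv := by
  induction X using Projectivization.ind with | _ x hx0 =>
  rw [Projectivization.submodule_mk, Submodule.mem_span_singleton] at h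
  obtain ⟨a, rfl⟩ := h
  have ha : a ≠ 0 := by
    rintro rfl
    simp at hv
  exact (Projectivization.mk_eq_mk_iff' _ _ _ _ _).2 ⟨a⁻¹, inv_smul_smul₀ ha x⟩

variable {K F : Type*} [Field K] [Field F] [Algebra K F]

theorem smul_eq_algebraMap_smul {V : Type*} [AddCommGroup V] [Module K V] [Module F V]
    [IsScalarTower K F V] (c : K) (v : V) : c • v = algebraMap K F c • v :=
  (algebraMap_smul F c v).symm

/-- The vector of `F × F × F` with coordinates `k` over `K` with respect to the basis `e`. -/
noncomputable def latticeVec (e : Module.Basis (Fin 3) F (F × F × F)) :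
    (Fin 3 → K) →ₗ[K] F × F × F :=
  Fintype.linearCombination K e

/-- The last coordinate of `latticeVec`. -/
noncomputable def latticeZ (e : Module.Basis (Fin 3) F (F × F × F)) : (Fin 3 → K) →ₗ[K] F :=
  ((LinearMap.snd K F F).comp (LinearMap.snd K F (F × F))).comp (latticeVec e)

variable {e : Module.Basis (Fin 3) F (F × F × F)}

theorem latticeZ_apply (k : Fin 3 → K) : latticeZ e k = (latticeVec e k).2.2 := rfl

theorem latticeVec_apply (k : Fin 3 → K) :
    latticeVec e k = ∑ i, algebraMap K F (k i) • e i := by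
  simp [latticeVec, Fintype.linearCombination_apply]

theorem latticeVec_eq_smul {k k' : Fin 3 → K} (hk' : k' ≠ 0) {c : F}
    (h : latticeVec e k = c • latticeVec e k') : ∃ d : K, k = d • k' := by
  rw [latticeVec_apply, latticeVec_apply, Finset.smul_sum, ← sub_eq_zero,
    ← Finset.sum_sub_distrib] at h
  simp only [smul_smul, ← sub_smul] at h
  have hi := Fintype.linearIndependent_iff.1 e.linearIndependent _ h
  obtain ⟨i, hi0⟩ := Function.ne_iff.1 hk'
  refine ⟨k i / k' i, funext fun j => ?_⟩
  have h1 := hi i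
  have h2 := hi j
  have hi0' : algebraMap K F (k' i) ≠ 0 := by simpa using hi0
  apply (algebraMap K F).injective
  simp only [Pi.smul_apply, smul_eq_mul, map_mul, map_div₀]
  field_simp
  linear_combination algebraMap K F (k' i) * h2 - algebraMap K F (k' j) * h1

theorem latticeVec_ne_zero {k : Fin 3 → K} (hk : k ≠ 0) : latticeVec e k ≠ 0 := by
  intro h
  rw [latticeVec_apply] at h
  apply hk
  funext i
  simpa using Fintype.linearIndependent_iff.1 e.linearIndependent _ h i

theorem mem_subplane_iff {P : ℙ F (F × F × F)} :
    P ∈ subplane K e ↔ ∃ (k : Fin 3 → K) (hk : k ≠ 0),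
      P = Projectivization.mk F (latticeVec e k) (latticeVec_ne_zero hk) := by
  constructor
  · rintro ⟨k, hk0, hk⟩
    rw [← latticeVec_apply] at hk0 hk
    refine ⟨k, ?_, eq_mk_of_mem_submodule hk0 hk⟩
    rintro rfl
    simp at hk0
  · rintro ⟨k, hk, rfl⟩
    refine ⟨k, ?_, ?_⟩ <;> rw [← latticeVec_apply]
    · exact latticeVec_ne_zero hk
    · rw [Projectivization.submodule_mk]
      exact Submodule.mem_span_singleton_self _

theorem mk_le_lineInf {x : F × F × F} (hx : x ≠ 0) :
    (Projectivization.mk F x hx).submodule ≤ lineInf F ↔ x.2.2 = 0 := by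
  rw [Projectivization.submodule_mk, Submodule.span_singleton_le_iff_mem]
  rfl

theorem exists_ker_latticeZ {T : ℙ F (F × F × F)}
    (hT : {P ∈ subplane K e | P.submodule ≤ lineInf F} = {T}) :
    ∃ (k₀ : Fin 3 → K) (hk₀ : k₀ ≠ 0),
      T = Projectivization.mk F (latticeVec e k₀) (latticeVec_ne_zero hk₀) ∧
      ∀ k, latticeZ e k = 0 ↔ ∃ c : K, k = c • k₀ := by
  have hTmem : T ∈ {P ∈ subplane K e | P.submodule ≤ lineInf F} := by rw [hT]; rfl
  obtain ⟨h1, h2⟩ := hTmem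
  obtain ⟨k₀, hk₀, rfl⟩ := mem_subplane_iff.1 h1
  refine ⟨k₀, hk₀, rfl, fun k => ⟨fun hk => ?_, ?_⟩⟩
  · rcases eq_or_ne k 0 with rfl | hk0
    · exact ⟨0, by simp⟩
    have : Projectivization.mk F (latticeVec e k) (latticeVec_ne_zero hk0) ∈
        {P ∈ subplane K e | P.submodule ≤ lineInf F} :=
      ⟨mem_subplane_iff.2 ⟨k, hk0, rfl⟩, (mk_le_lineInf _).2 hk⟩
    rw [hT, Set.mem_singleton_iff, Projectivization.mk_eq_mk_iff'] at this
    obtain ⟨c, hc⟩ := this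
    exact latticeVec_eq_smul hk₀ hc.symm
  · rintro ⟨c, rfl⟩
    rw [map_smul, latticeZ_apply, (mk_le_lineInf _).1 h2, smul_zero]

/-- The line of `P` and `Q` meets `ℓ∞` where the combination of `p` and `q` has last coordinate
zero. If the last coordinates of `p` and `q` were dependent over `K`, that intersection would be a
point of the subplane, hence the centre. -/
theorem exists_of_le_sup {k₀ : Fin 3 → K} (hk₀ : k₀ ≠ 0)
    (hker : ∀ k, latticeZ e k = 0 ↔ ∃ c : K, k = c • k₀)
    {P Q X : ℙ F (F × F × F)} (hP : P ∈ subplane K e) (hQ : Q ∈ subplane K e) (hPQ : P ≠ Q)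
    (hX : X.submodule ≤ lineInf F) (hXPQ : X.submodule ≤ P.submodule ⊔ Q.submodule)
    (hXT : X ≠ Projectivization.mk F (latticeVec e k₀) (latticeVec_ne_zero hk₀)) :
    ∃ p q : Fin 3 → K, LinearIndependent K ![latticeZ e p, latticeZ e q] ∧
      latticeZ e q • latticeVec e p - latticeZ e p • latticeVec e q ∈ X.submodule ∧
      latticeZ e q • latticeVec e p - latticeZ e p • latticeVec e q ≠ 0 := by
  obtain ⟨p, hp, rfl⟩ := mem_subplane_iff.1 hP
  obtain ⟨q, hq, rfl⟩ := mem_subplane_iff.1 hQ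
  induction X using Projectivization.ind with | _ x hx0 =>
  rw [mk_le_lineInf] at hX
  simp only [Projectivization.submodule_mk, Submodule.span_singleton_le_iff_mem,
    Submodule.mem_sup, Submodule.mem_span_singleton] at hXPQ
  obtain ⟨_, ⟨α, rfl⟩, _, ⟨β, rfl⟩, hx⟩ := hXPQ
  have hz : α * latticeZ e p + β * latticeZ e q = 0 := by
    have := congrArg (fun x => x.2.2) hx
    simpa [hX, latticeZ_apply] using this
  have hpq : ∀ a c : F, a • latticeVec e p + c • latticeVec e q = 0 → a = 0 ∧ c = 0 := by
    have h := Projectivization.linearIndependent_pair_iff_ne.2 hPQ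
    obtain ⟨u, hu⟩ := Projectivization.exists_smul_eq_mk_rep F _ (latticeVec_ne_zero (e := e) hp)
    obtain ⟨w, hw⟩ := Projectivization.exists_smul_eq_mk_rep F _ (latticeVec_ne_zero (e := e) hq)
    rw [← hu, ← hw, LinearIndependent.pair_iff] at h
    intro a c hac
    have := h (a * (u⁻¹ : Fˣ)) (c * (w⁻¹ : Fˣ)) (by
      simpa [Units.smul_def, smul_smul, mul_assoc] using hac)
    simpa using this
  have hli : LinearIndependent K ![latticeZ e p, latticeZ e q] := by
    rw [LinearIndependent.pair_iff]
    by_contra! hcon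
    obtain ⟨s, u, hsu, hne⟩ := hcon
    apply hXT
    obtain ⟨c, hc⟩ := (hker (s • p + u • q)).1 (by simpa using hsu)
    have hc' := congrArg (latticeVec e) hc
    rw [map_add, map_smul, map_smul, map_smul] at hc'
    have hsu' : algebraMap K F s * latticeZ e p + algebraMap K F u * latticeZ e q = 0 := by
      simpa [Algebra.smul_def] using hsu
    have hprop : ∃ r : F, x = r • (s • latticeVec e p + u • latticeVec e q) := by
      have hdet : α * algebraMap K F u - β * algebraMap K F s = 0 := by
        by_contra hd
        have zp : latticeZ e p = 0 := by
          apply mul_left_cancel₀ hd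
          linear_combination algebraMap K F u * hz - β * hsu'
        have zq : latticeZ e q = 0 := by
          apply mul_left_cancel₀ hd
          linear_combination α * hsu' - algebraMap K F s * hz
        obtain ⟨c1, h1⟩ := (hker p).1 zp
        obtain ⟨c2, h2⟩ := (hker q).1 zq
        have h3 := hpq (algebraMap K F c2) (-algebraMap K F c1) (by
          rw [h1, h2]
          simp only [map_smul, neg_smul, algebraMap_smul, smul_smul, mul_comm, add_neg_cancel])
        have h4 : c1 = 0 := by simpa using h3.2
        exact hp (by rw [h1, h4, zero_smul])
      rcases eq_or_ne s 0 with rfl | hs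
      · have hu := hne rfl
        have hu' : algebraMap K F u ≠ 0 := by simpa using hu
        have hα : α = 0 := by simpa [hu'] using hdet
        refine ⟨β / algebraMap K F u, ?_⟩
        rw [← hx, hα, ← algebraMap_smul F u, zero_smul, zero_smul, zero_add, zero_add, smul_smul,
          div_mul_cancel₀ _ hu']
      · have hs' : algebraMap K F s ≠ 0 := by simpa using hs
        refine ⟨α / algebraMap K F s, ?_⟩
        rw [← hx, ← algebraMap_smul F u, ← algebraMap_smul F s, smul_add, smul_smul, smul_smul,
          div_mul_cancel₀ _ hs']
        congr 2
        field_simp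
        linear_combination -hdet
    obtain ⟨r, hr⟩ := hprop
    rw [hc', ← algebraMap_smul F c, smul_smul] at hr
    rw [Projectivization.mk_eq_mk_iff']
    exact ⟨_, hr.symm⟩
  refine ⟨p, q, hli, ?_, ?_⟩
  · rw [LinearIndependent.pair_iff] at hli
    have zq : latticeZ e q ≠ 0 := fun h => one_ne_zero (hli 0 1 (by simp [h])).2
    have hα : α ≠ 0 := by
      rintro rfl
      have hβ : β = 0 := by simpa [zq] using hz
      simp [hβ] at hx
      exact hx0 hx.symm
    rw [Projectivization.submodule_mk, Submodule.mem_span_singleton]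
    refine ⟨latticeZ e q / α, ?_⟩
    rw [← hx, smul_add, smul_smul, smul_smul, div_mul_cancel₀ _ hα, sub_eq_add_neg, ← neg_smul]
    congr 2
    field_simp
    linear_combination hz
  · intro h
    rw [sub_eq_add_neg, ← neg_smul] at h
    rw [LinearIndependent.pair_iff] at hli
    exact one_ne_zero (hli 0 1 (by simp [(hpq _ _ h).1])).2

/-- The form of a tangent splash with centre `T` in coordinates adapted to one of its points. -/
theorem IsTangentSplash.exists_coordinates {S : Set (ℙ F (F × F × F))} {T L : ℙ F (F × F × F)}
    (hS : IsTangentSplash K S T) (hL : L ∈ S) (hLT : L ≠ T) :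
    ∃ (l t : F × F × F) (hl0 : l ≠ 0) (ht0 : t ≠ 0) (W : Submodule K F),
      L = Projectivization.mk F l hl0 ∧ T = Projectivization.mk F t ht0 ∧
      l ∈ lineInf F ∧ t ∈ lineInf F ∧ Module.finrank K W = 2 ∧
      ∀ X, X ∈ S ↔ X = T ∨ ∃ w ∈ W, X.submodule = F ∙ (l + w • t) := by
  obtain ⟨e, hT, rfl⟩ := hS
  obtain ⟨k₀, hk₀, rfl, hker⟩ := exists_ker_latticeZ hT
  obtain ⟨hLinf, P, hP, Q, hQ, hPQ, hLPQ⟩ := hL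
  obtain ⟨p, q, hli, hmem, hne⟩ := exists_of_le_sup hk₀ hker hP hQ hPQ hLinf hLPQ hLT
  have hz₀ : latticeZ e k₀ = 0 := (hker k₀).2 ⟨1, (one_smul _ _).symm⟩
  have hl := eq_mk_of_mem_submodule hne hmem
  set l := latticeZ e q • latticeVec e p - latticeZ e p • latticeVec e q with hldef
  set t := latticeVec e k₀ with htdef
  -- The last coordinate on the lattice has a one-dimensional kernel, the centre, so its values form
  -- a plane of `F` over `K`. This plane is the `W` of the splash.
  have hspan : LinearMap.range (latticeZ (K := K) e) =
      Submodule.span K {latticeZ e p, latticeZ e q} := by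
    have h1 := LinearMap.finrank_range_add_finrank_ker (latticeZ (K := K) e)
    have h2 : LinearMap.ker (latticeZ (K := K) e) = K ∙ k₀ := by
      ext k
      rw [LinearMap.mem_ker, hker, Submodule.mem_span_singleton]
      simp only [eq_comm]
    rw [h2, finrank_span_singleton hk₀, Module.finrank_fin_fun] at h1
    symm
    apply Submodule.eq_of_le_of_finrank_eq
    · rw [Submodule.span_le]
      rintro _ (rfl | rfl)
      exacts [⟨p, rfl⟩, ⟨q, rfl⟩]
    · have := finrank_span_eq_card hli
      rw [Matrix.range_cons_cons_empty, Fintype.card_fin] at this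
      omega
  have hW : Module.finrank K (LinearMap.range (latticeZ (K := K) e)) = 2 := by
    have := finrank_span_eq_card hli
    rw [Matrix.range_cons_cons_empty, Fintype.card_fin] at this
    rw [hspan, this]
  have hdecomp : ∀ k : Fin 3 → K, ∃ x y c : K, k = x • p + y • q + c • k₀ := by
    intro k
    have : latticeZ e k ∈ LinearMap.range (latticeZ (K := K) e) := ⟨k, rfl⟩
    rw [hspan, Submodule.mem_span_pair] at this
    obtain ⟨x, y, hxy⟩ := this
    obtain ⟨c, hc⟩ := (hker (k - (x • p + y • q))).1 (by
      rw [map_sub, ← hxy, map_add, map_smul, map_smul, sub_self])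
    exact ⟨x, y, c, by rw [← hc]; abel⟩
  have hl2 : l.2.2 = 0 := by
    simp only [hldef, Prod.snd_sub, Prod.smul_snd, ← latticeZ_apply, smul_eq_mul]
    ring
  refine ⟨l, t, hne, latticeVec_ne_zero hk₀, LinearMap.range (latticeZ (K := K) e), hl, rfl, hl2,
    hz₀, hW, fun X => ?_⟩
  have hp0 : latticeZ e p ≠ 0 := fun h =>
    one_ne_zero ((LinearIndependent.pair_iff.1 hli) 1 0 (by simp [h])).1
  have hq0 : latticeZ e q ≠ 0 := fun h =>
    one_ne_zero ((LinearIndependent.pair_iff.1 hli) 0 1 (by simp [h])).2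
  have hneq : ∀ k k' : Fin 3 → K, ∀ hk : k ≠ 0, ∀ hk' : k' ≠ 0,
      (∀ c : K, latticeZ e k ≠ c • latticeZ e k') →
      Projectivization.mk F (latticeVec e k) (latticeVec_ne_zero hk) ≠
        Projectivization.mk F (latticeVec e k') (latticeVec_ne_zero hk') := by
    intro k k' hk hk' h heq
    rw [Projectivization.mk_eq_mk_iff'] at heq
    obtain ⟨c, hc⟩ := heq
    obtain ⟨d, rfl⟩ := latticeVec_eq_smul hk' hc.symm
    exact h d (map_smul _ _ _)
  have hne_of_z : ∀ k : Fin 3 → K, latticeZ e k ≠ 0 → k ≠ 0 := by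
    rintro _ h rfl
    exact h (map_zero _)
  constructor
  · rintro ⟨hX, P', hP', Q', hQ', hPQ', hXPQ'⟩
    by_cases hXT : X = Projectivization.mk F t (latticeVec_ne_zero hk₀)
    · exact Or.inl hXT
    right
    obtain ⟨p', q', hli', hmem', hne'⟩ := exists_of_le_sup hk₀ hker hP' hQ' hPQ' hX hXPQ' hXT
    rw [eq_mk_of_mem_submodule hne' hmem', Projectivization.submodule_mk]
    obtain ⟨x, y, c, rfl⟩ := hdecomp p'
    obtain ⟨x', y', c', rfl⟩ := hdecomp q'
    have zp' : latticeZ e (x • p + y • q + c • k₀) = x • latticeZ e p + y • latticeZ e q := by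
      simp [hz₀]
    have zq' : latticeZ e (x' • p + y' • q + c' • k₀) =
        x' • latticeZ e p + y' • latticeZ e q := by
      simp [hz₀]
    rw [zp', zq'] at hli' ⊢
    have hD : x * y' - y * x' ≠ 0 := by
      intro hD
      rw [LinearIndependent.pair_iff] at hli'
      have h1 := hli' x' (-x) (by
        simp only [Algebra.smul_def, map_neg]
        have := congrArg (algebraMap K F) hD
        simp only [map_sub, map_mul, map_zero] at this
        linear_combination -(latticeZ e q) * this)
      have h2 := hli' y' (-y) (by
        simp only [Algebra.smul_def, map_neg]
        have := congrArg (algebraMap K F) hD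
        simp only [map_sub, map_mul, map_zero] at this
        linear_combination (latticeZ e p) * this)
      have := hli' 1 0 (by simp [neg_eq_zero.1 h1.2, neg_eq_zero.1 h2.2])
      exact one_ne_zero this.1
    have hD' : algebraMap K F (x * y' - y * x') ≠ 0 := (map_ne_zero _).2 hD
    -- In the expansion along `p`, `q`, `k₀`, the part on `p` and `q` is the determinant times `l`,
    -- and `c`, `c'` contribute only multiples of `t`.
    refine ⟨(x * y' - y * x')⁻¹ • (c • latticeZ e (x' • p + y' • q) -
      c' • latticeZ e (x • p + y • q)), ⟨(x * y' - y * x')⁻¹ • (c • (x' • p + y' • q) -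
      c' • (x • p + y • q)), by simp only [map_smul, map_sub]⟩, ?_⟩
    have : (x' • latticeZ e p + y' • latticeZ e q) • latticeVec e (x • p + y • q + c • k₀) -
        (x • latticeZ e p + y • latticeZ e q) • latticeVec e (x' • p + y' • q + c' • k₀) =
        algebraMap K F (x * y' - y * x') • (l + ((x * y' - y * x')⁻¹ •
          (c • latticeZ e (x' • p + y' • q) - c' • latticeZ e (x • p + y • q))) • t) := by
      rw [Algebra.smul_def (x * y' - y * x')⁻¹, map_inv₀, smul_add, smul_smul,
        mul_inv_cancel_left₀ hD', hldef]
      simp only [map_add, map_smul, ← htdef]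
      simp only [smul_eq_algebraMap_smul (K := K) (F := F) (V := F × F × F),
        Algebra.smul_def (R := K) (A := F), map_sub, map_mul]
      module
    rw [this]
    exact Submodule.span_singleton_smul_eq (isUnit_iff_ne_zero.2 hD') _
  · rintro (rfl | ⟨w, ⟨k, rfl⟩, hX⟩)
    · refine ⟨(mk_le_lineInf _).2 hz₀, _, mem_subplane_iff.2 ⟨k₀, hk₀, rfl⟩,
        _, mem_subplane_iff.2 ⟨p, hne_of_z p hp0, rfl⟩, ?_, le_sup_left⟩
      refine (hneq p k₀ (hne_of_z p hp0) hk₀ fun c hc => ?_).symm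
      rw [hz₀, smul_zero] at hc
      exact hp0 hc
    · obtain ⟨x, y, c, rfl⟩ := hdecomp k
      have zp' : latticeZ e (p + y • k₀) = latticeZ e p := by simp [hz₀]
      have zq' : latticeZ e (q - x • k₀) = latticeZ e q := by simp [hz₀]
      -- Shifting `p` and `q` along `k₀` leaves their last coordinates alone and adds `y z(q) + x
      -- z(p)` to the coefficient of `t`, which is the required `w`.
      refine ⟨?_, _, mem_subplane_iff.2 ⟨p + y • k₀, hne_of_z _ (by rwa [zp']), rfl⟩,
        _, mem_subplane_iff.2 ⟨q - x • k₀, hne_of_z _ (by rwa [zq']), rfl⟩, ?_, ?_⟩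
      · rw [hX, Submodule.span_singleton_le_iff_mem, mem_lineInf]
        simp [hl2, htdef, ← latticeZ_apply, hz₀]
      · refine hneq _ _ (hne_of_z _ (by rwa [zp'])) (hne_of_z _ (by rwa [zq'])) fun c hc => ?_
        rw [zp', zq'] at hc
        exact one_ne_zero ((LinearIndependent.pair_iff.1 hli) 1 (-c) (by simp [hc])).1
      · rw [hX, Submodule.span_singleton_le_iff_mem, Projectivization.submodule_mk,
          Projectivization.submodule_mk]
        have : l + latticeZ e (x • p + y • q + c • k₀) • t =
            latticeZ e q • latticeVec e (p + y • k₀) +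
              (-latticeZ e p) • latticeVec e (q - x • k₀) := by
          rw [hldef]
          simp only [map_add, map_sub, map_smul, hz₀, ← htdef]
          simp only [smul_eq_algebraMap_smul (K := K) (F := F) (V := F × F × F),
            Algebra.smul_def (R := K) (A := F)]
          module
        rw [this]
        exact Submodule.add_mem_sup (Submodule.smul_mem _ _ (Submodule.mem_span_singleton_self _))
          (Submodule.smul_mem _ _ (Submodule.mem_span_singleton_self _))

end Splash

/-! ### Cover planes through a given point of `[L]`. -/

section CoverPlanes

variable {K F : Type*} [Field K] [Field F] [Algebra K F] {b : Module.Basis (Fin 3) K F}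

theorem mem_bb_iff {X : ℙ F (F × F × F)} {v : V7 K} :
    v ∈ bb b X ↔ sigmaInv b v ∈ X.submodule := Iff.rfl

variable {l t : F × F × F}

theorem coeffs_eq_zero_of_mk_ne (hl0 : l ≠ 0) (ht0 : t ≠ 0)
    (hne : Projectivization.mk F l hl0 ≠ Projectivization.mk F t ht0) {a c : F}
    (h : a • l + c • t = 0) : a = 0 ∧ c = 0 := by
  have ha : a = 0 := by
    by_contra ha
    apply hne
    rw [Projectivization.mk_eq_mk_iff']
    refine ⟨-(c / a), ?_⟩
    apply smul_right_injective _ ha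
    simp only [smul_smul]
    rw [mul_neg, mul_div_cancel₀ _ ha, neg_smul, eq_comm]
    exact eq_neg_of_add_eq_zero_left h
  subst ha
  simpa [ht0] using h

theorem coeffs_eq_of_mk_ne (hl0 : l ≠ 0) (ht0 : t ≠ 0)
    (hne : Projectivization.mk F l hl0 ≠ Projectivization.mk F t ht0) {a c a' c' : F}
    (h : a • l + c • t = a' • l + c' • t) : a = a' ∧ c = c' := by
  have := coeffs_eq_zero_of_mk_ne hl0 ht0 hne (a := a - a') (c := c - c') (by
    rw [sub_smul, sub_smul, sub_add_sub_comm, h, sub_self])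
  exact ⟨sub_eq_zero.1 this.1, sub_eq_zero.1 this.2⟩

/-- The cover plane through the point `σ(d l)` of the spread element of `l`. -/
noncomputable def coverPlane (b : Module.Basis (Fin 3) K F) (l t : F × F × F) (W : Submodule K F)
    (d : F) : Submodule K (V7 K) :=
  (K ∙ emb b l d) ⊔ (d • W).map (emb b t)

variable (hl : l ∈ lineInf F) (ht : t ∈ lineInf F) (hl0 : l ≠ 0) (ht0 : t ≠ 0)
  (hne : Projectivization.mk F l hl0 ≠ Projectivization.mk F t ht0)
include hl ht hne

omit ht in
theorem emb_notMem_bb {d : F} (hd : d ≠ 0) : emb b l d ∉ bb b (Projectivization.mk F t ht0) := by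
  rw [mem_bb, sigmaInv_emb hl]
  rintro ⟨c, hc⟩
  exact hd (coeffs_eq_zero_of_mk_ne hl0 ht0 hne (a := d) (c := -c) (by simp [hc])).1

theorem span_emb_sup_inf_bb {d : F} (hd : d ≠ 0) (U : Submodule K F) :
    ((K ∙ emb b l d) ⊔ U.map (emb b t)) ⊓ bb b (Projectivization.mk F t ht0) =
      U.map (emb b t) := by
  have hU : U.map (emb b t) ≤ bb b (Projectivization.mk F t ht0) := by
    rw [bb_eq_range ht]
    exact LinearMap.map_le_range
  refine le_antisymm ?_ (le_inf le_sup_right hU)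
  rintro v ⟨hv, hvT⟩
  obtain ⟨_, hk, u, hu, rfl⟩ := Submodule.mem_sup.1 hv
  obtain ⟨k, rfl⟩ := Submodule.mem_span_singleton.1 hk
  have h1 := (Submodule.add_mem_iff_left _ (hU hu)).1 hvT
  rcases eq_or_ne k 0 with rfl | hk0
  · simpa using hu
  · exact (emb_notMem_bb hl hl0 ht0 hne hd ((Submodule.smul_mem_iff _ hk0).1 h1)).elim

theorem finrank_span_emb_sup {d : F} (hd : d ≠ 0) (U : Submodule K F) :
    Module.finrank K ↥((K ∙ emb b l d) ⊔ U.map (emb b t)) = 1 + Module.finrank K U := by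
  have hfin : FiniteDimensional K F := Module.Basis.finiteDimensional_of_finite b
  have h1 := Submodule.finrank_sup_add_finrank_inf_eq (K ∙ emb b l d) (U.map (emb b t))
  have h2 : (K ∙ emb b l d) ⊓ U.map (emb b t) = ⊥ := by
    rw [eq_bot_iff]
    rintro v ⟨hv1, hv2⟩
    obtain ⟨k, rfl⟩ := Submodule.mem_span_singleton.1 hv1
    have hv3 : k • emb b l d ∈ bb b (Projectivization.mk F t ht0) := by
      rw [bb_eq_range ht]
      exact LinearMap.map_le_range hv2
    rcases eq_or_ne k 0 with rfl | hk
    · simp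
    · exact (emb_notMem_bb hl hl0 ht0 hne hd ((Submodule.smul_mem_iff _ hk).1 hv3)).elim
  have h3 : emb b l d ≠ 0 := fun h => hd (emb_injective hl hl0 (h.trans (map_zero _).symm))
  rw [h2, finrank_bot, finrank_span_singleton h3] at h1
  rw [← (Submodule.equivMapOfInjective _ (emb_injective (b := b) ht ht0) U).finrank_eq] at h1
  omega

variable {S : Set (ℙ F (F × F × F))} {W : Submodule K F} (hW : Module.finrank K W = 2)
  (hS : ∀ X, X ∈ S ↔ X = Projectivization.mk F t ht0 ∨ ∃ w ∈ W, X.submodule = F ∙ (l + w • t))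
include hW hS

/-- The plane meets the spread element of `l + w t` in `σ(d (l + w t))`, because `d w ∈ d W`. -/
theorem isCoverPlane_coverPlane {d : F} (hd : d ≠ 0) :
    IsCoverPlane b S (Projectivization.mk F t ht0) (coverPlane b l t W d) := by
  refine ⟨?_, ?_, ?_, ?_⟩
  · refine sup_le ?_ ?_
    · rw [Submodule.span_singleton_le_iff_mem]
      rfl
    · rintro _ ⟨u, -, rfl⟩
      rfl
  · rw [coverPlane, finrank_span_emb_sup hl ht hl0 ht0 hne hd, finrank_smul_submodule hd, hW]
  · intro X hX hbot
    obtain ⟨w, hw, hw0⟩ := W.exists_mem_ne_zero_of_ne_bot (by rintro rfl; simp at hW)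
    have hdw : ∀ w ∈ W, emb b t (d * w) ∈ coverPlane b l t W d := fun w hw =>
      Submodule.mem_sup_right ⟨d * w, Submodule.smul_mem_pointwise_smul w d W hw, rfl⟩
    rcases (hS X).1 hX with rfl | ⟨w, hw, hX⟩
    · have := (Submodule.eq_bot_iff _).1 hbot _ ⟨hdw w hw, emb_mem_bb ht ht0 _⟩
      have := emb_injective ht ht0 (this.trans (map_zero _).symm)
      simp [hd, hw0] at this
    · have h1 := (Submodule.eq_bot_iff _).1 hbot (emb b l d + emb b t (d * w))
        ⟨Submodule.add_mem _ (Submodule.mem_sup_left (Submodule.mem_span_singleton_self _))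
          (hdw w hw), by
          rw [SetLike.mem_coe, mem_bb_iff, hX, map_add, sigmaInv_emb hl, sigmaInv_emb ht]
          exact Submodule.mem_span_singleton.2 ⟨d, by rw [smul_add, smul_smul]⟩⟩
      have h2 := congrArg (sigmaInv b) h1
      rw [map_add, sigmaInv_emb hl, sigmaInv_emb ht, map_zero] at h2
      exact hd (coeffs_eq_zero_of_mk_ne hl0 ht0 hne h2).1
  · rw [coverPlane, span_emb_sup_inf_bb hl ht hl0 ht0 hne hd,
      ← (Submodule.equivMapOfInjective _ (emb_injective (b := b) ht ht0) _).finrank_eq,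
      finrank_smul_submodule hd, hW]

/-- Let `π` meet `[T]` in `σ(U t)`. A common vector with the spread element of `l + w t` has the
form `σ(k d l + u t)` with `u = k d w` and `k ≠ 0`, so `d w ∈ U`. Thus `d W ≤ U`, and the dimensions
agree. -/
theorem IsCoverPlane.eq_coverPlane {d : F} (hd : d ≠ 0) {π : Submodule K (V7 K)}
    (hπ : IsCoverPlane b S (Projectivization.mk F t ht0) π) (hdπ : emb b l d ∈ π) :
    π = coverPlane b l t W d := by
  have hfin : FiniteDimensional K F := Module.Basis.finiteDimensional_of_finite b
  obtain ⟨-, h3, hmeet, h2⟩ := hπ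
  let U : Submodule K F := π.comap (emb b t)
  have hU : π ⊓ bb b (Projectivization.mk F t ht0) = U.map (emb b t) := by
    rw [bb_eq_range ht, Submodule.map_comap_eq, inf_comm]
  have hU2 : Module.finrank K U = 2 := by
    rw [hU] at h2
    rw [← h2, ← (Submodule.equivMapOfInjective _ (emb_injective (b := b) ht ht0) U).finrank_eq]
  have hπU : (K ∙ emb b l d) ⊔ U.map (emb b t) = π := by
    apply Submodule.eq_of_le_of_finrank_eq
    · refine sup_le ((Submodule.span_singleton_le_iff_mem _ _).2 hdπ) ?_
      rw [← hU]
      exact inf_le_left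
    · rw [finrank_span_emb_sup hl ht hl0 ht0 hne hd, hU2, h3]
  have hdW : d • W = U := by
    apply Submodule.eq_of_le_of_finrank_eq
    · intro x hx
      obtain ⟨w, hw, rfl⟩ := (Submodule.mem_smul_pointwise_iff_exists _ _ _).1 hx
      have hx0 : l + w • t ≠ 0 := fun h =>
        one_ne_zero (coeffs_eq_zero_of_mk_ne hl0 ht0 hne (a := 1) (c := w) (by rwa [one_smul])).1
      have hXS : Projectivization.mk F _ hx0 ∈ S :=
        (hS _).2 (Or.inr ⟨w, hw, Projectivization.submodule_mk _ _⟩)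
      obtain ⟨v, ⟨hvπ, hvX⟩, hv0⟩ := Submodule.exists_mem_ne_zero_of_ne_bot (hmeet _ hXS)
      rw [← hπU, SetLike.mem_coe, Submodule.mem_sup] at hvπ
      obtain ⟨_, hk, _, ⟨u, hu, rfl⟩, rfl⟩ := hvπ
      obtain ⟨k, rfl⟩ := Submodule.mem_span_singleton.1 hk
      rw [SetLike.mem_coe, mem_bb] at hvX
      obtain ⟨c, hc⟩ := hvX
      rw [map_add, map_smul, sigmaInv_emb hl, sigmaInv_emb ht,
        smul_eq_algebraMap_smul (F := F) k, smul_smul, smul_add, smul_smul] at hc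
      obtain ⟨e1, e2⟩ := coeffs_eq_of_mk_ne hl0 ht0 hne hc
      have hk0 : k ≠ 0 := by
        rintro rfl
        rw [map_zero, zero_mul] at e1
        rw [← e1, zero_mul] at e2
        simp [e2] at hv0
      have : u = k • (d • w) := by
        rw [e2, ← e1, Algebra.smul_def, smul_eq_mul, mul_assoc]
      rw [this] at hu
      exact (Submodule.smul_mem_iff _ hk0).1 hu
    · rw [finrank_smul_submodule hd, hW, hU2]
  rw [coverPlane, hdW, hπU]

end CoverPlanes

/-! ### Tangents and injectivity for conics and twisted cubics. -/

namespace NormalCurve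

variable {R M : Type*} [Field R] [AddCommGroup M] [Module R M] {n : ℕ}

theorem point_mk (N : NormalCurve R M n) {p : Fin 2 → R} (hp : p ≠ 0) :
    N.point (Projectivization.mk R p hp) = Projectivization.mk R (N.vec p) (N.vec_ne_zero hp) := rfl

theorem point_eq_mk_rep (N : NormalCurve R M n) (x : ℙ R (Fin 2 → R)) :
    N.point x = Projectivization.mk R (N.vec x.rep) (N.vec_ne_zero x.rep_nonzero) := by
  conv_lhs => rw [← x.mk_rep]
  rfl

theorem mem_tangentLine {N : NormalCurve R M n} {x : ℙ R (Fin 2 → R)} {v : M} :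
    v ∈ N.tangentLine x ↔ ∃ (a : R) (u : Fin 2 → R), v = a • N.vec x.rep + N.dvec x.rep u := by
  let D : (Fin 2 → R) →ₗ[R] M :=
    { toFun := N.dvec x.rep
      map_add' := fun u w => by
        simp only [dvec, ← Finset.sum_add_distrib, ← add_smul, Pi.add_apply]
        refine Finset.sum_congr rfl fun i _ => ?_
        congr 1
        ring
      map_smul' := fun c u => by
        simp only [dvec, Finset.smul_sum, smul_smul, Pi.smul_apply, smul_eq_mul, RingHom.id_apply]
        refine Finset.sum_congr rfl fun i _ => ?_
        congr 1
        ring }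
  have hD : Submodule.span R (Set.range (N.dvec x.rep)) = LinearMap.range D := by
    rw [show Set.range (N.dvec x.rep) = (LinearMap.range D : Set M) from rfl, Submodule.span_eq]
  rw [tangentLine, Submodule.mem_span_insert, hD]
  constructor
  · rintro ⟨a, _, ⟨u, rfl⟩, rfl⟩
    exact ⟨a, u, rfl⟩
  · rintro ⟨a, u, rfl⟩
    exact ⟨a, _, ⟨u, rfl⟩, rfl⟩

theorem vec_two (C : NormalCurve R M 2) (p : Fin 2 → R) :
    C.vec p = p 0 ^ 2 • C.frame 0 + (p 0 * p 1) • C.frame 1 + p 1 ^ 2 • C.frame 2 := by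
  simp [vec, Fin.sum_univ_three]

theorem dvec_two (C : NormalCurve R M 2) (p u : Fin 2 → R) :
    C.dvec p u = (2 * u 0 * p 0) • C.frame 0 + (u 0 * p 1 + u 1 * p 0) • C.frame 1 +
      (2 * u 1 * p 1) • C.frame 2 := by
  refine (Fin.sum_univ_three _).trans ?_
  simp
  module

theorem vec_three (N : NormalCurve R M 3) (p : Fin 2 → R) :
    N.vec p = p 0 ^ 3 • N.frame 0 + (p 0 ^ 2 * p 1) • N.frame 1 + (p 0 * p 1 ^ 2) • N.frame 2 +
      p 1 ^ 3 • N.frame 3 := by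
  simp [vec, Fin.sum_univ_four]

theorem dvec_three (N : NormalCurve R M 3) (p u : Fin 2 → R) :
    N.dvec p u = (3 * u 0 * p 0 ^ 2) • N.frame 0 +
      (2 * u 0 * p 0 * p 1 + u 1 * p 0 ^ 2) • N.frame 1 +
      (u 0 * p 1 ^ 2 + 2 * u 1 * p 0 * p 1) • N.frame 2 + (3 * u 1 * p 1 ^ 2) • N.frame 3 := by
  refine (Fin.sum_univ_four _).trans ?_
  simp
  module

theorem mk_eq_of_det_eq_zero {p q : Fin 2 → R} (hp : p ≠ 0) (hq : q ≠ 0)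
    (h : p 0 * q 1 = p 1 * q 0) : Projectivization.mk R p hp = Projectivization.mk R q hq := by
  rw [Projectivization.mk_eq_mk_iff']
  rcases eq_or_ne (q 0) 0 with h0 | h0
  · have h1 : q 1 ≠ 0 := fun h1 => hq (funext fun i => by fin_cases i <;> assumption)
    refine ⟨p 1 / q 1, funext fun i => ?_⟩
    have h2 : p 0 = 0 := by simpa [h0, h1] using h
    fin_cases i
    · simp [h0, h2]
    · simp [h1]
  · refine ⟨p 0 / q 0, funext fun i => ?_⟩
    fin_cases i
    · simp [h0]
    · simp only [Fin.mk_one, Pi.smul_apply, smul_eq_mul]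
      field_simp
      rw [h, mul_comm]

theorem eq_of_rep_det_eq_zero {x y : ℙ R (Fin 2 → R)}
    (h : x.rep 0 * y.rep 1 = x.rep 1 * y.rep 0) : x = y := by
  rw [← x.mk_rep, ← y.mk_rep]
  exact mk_eq_of_det_eq_zero _ _ h

theorem eq_of_vec_mem_tangentLine {C : NormalCurve R M 2} {x y : ℙ R (Fin 2 → R)}
    (h : C.vec y.rep ∈ C.tangentLine x) : y = x := by
  obtain ⟨a, u, h⟩ := mem_tangentLine.1 h
  rw [vec_two, vec_two, dvec_two] at h
  set p := x.rep
  set r := y.rep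
  have hi := Fintype.linearIndependent_iff.1 C.indep ![r 0 ^ 2 - a * p 0 ^ 2 - 2 * u 0 * p 0,
    r 0 * r 1 - a * (p 0 * p 1) - (u 0 * p 1 + u 1 * p 0),
    r 1 ^ 2 - a * p 1 ^ 2 - 2 * u 1 * p 1] (by
      refine (Fin.sum_univ_three _).trans ?_
      simp only [Matrix.cons_val]
      rw [← sub_eq_zero] at h
      rw [← h]
      module)
  have e0 := hi 0
  have e1 := hi 1
  have e2 := hi 2
  simp only [Matrix.cons_val] at e0 e1 e2
  apply eq_of_rep_det_eq_zero
  rw [← sub_eq_zero]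
  apply eq_zero_of_pow_eq_zero (n := 2)
  -- This functional annihilates the point with parameter `p` and all derivatives there. On the
  -- point with parameter `r` it is the square of the determinant of `p` and `r`, also in
  -- characteristic two.
  linear_combination p 1 ^ 2 * e0 - 2 * p 0 * p 1 * e1 + p 0 ^ 2 * e2

theorem vec_mem_tangentLine (C : NormalCurve R M n) (x : ℙ R (Fin 2 → R)) :
    C.vec x.rep ∈ C.tangentLine x := Submodule.subset_span (Set.mem_insert _ _)

theorem point_three_injective (N : NormalCurve R M 3) : Function.Injective N.point := by
  intro x y h
  rw [point_eq_mk_rep, point_eq_mk_rep, Projectivization.mk_eq_mk_iff'] at h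
  obtain ⟨c, h⟩ := h
  rw [vec_three, vec_three] at h
  set p := x.rep
  set r := y.rep
  have hr : ¬(r 0 = 0 ∧ r 1 = 0) := fun h =>
    y.rep_nonzero (funext fun i => by fin_cases i; exacts [h.1, h.2])
  have hp : ¬(p 0 = 0 ∧ p 1 = 0) := fun h =>
    x.rep_nonzero (funext fun i => by fin_cases i; exacts [h.1, h.2])
  have hi := Fintype.linearIndependent_iff.1 N.indep ![c * r 0 ^ 3 - p 0 ^ 3,
    c * (r 0 ^ 2 * r 1) - p 0 ^ 2 * p 1, c * (r 0 * r 1 ^ 2) - p 0 * p 1 ^ 2,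
    c * r 1 ^ 3 - p 1 ^ 3] (by
      refine (Fin.sum_univ_four _).trans ?_
      simp only [Matrix.cons_val]
      rw [← sub_eq_zero] at h
      rw [← h]
      module)
  have e0 := hi 0
  have e1 := hi 1
  have e2 := hi 2
  have e3 := hi 3
  simp only [Matrix.cons_val] at e0 e1 e2 e3
  apply eq_of_rep_det_eq_zero
  rw [← sub_eq_zero]
  change p 0 * r 1 - p 1 * r 0 = 0
  have k0 : p 0 ^ 2 * (p 0 * r 1 - p 1 * r 0) = 0 := by
    linear_combination r 0 * e1 - r 1 * e0
  have k1 : p 1 ^ 2 * (p 0 * r 1 - p 1 * r 0) = 0 := by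
    linear_combination r 0 * e3 - r 1 * e2
  rcases eq_or_ne (p 0) 0 with h0 | h0
  · have h1 : p 1 ≠ 0 := fun h1 => hp ⟨h0, h1⟩
    simpa [h1] using k1
  · simpa [h0] using k0

end NormalCurve

/-! ### Linear forms with a root outside `K`. -/

section LinearForms

variable {K F : Type*} [Field K] [Field F] [Algebra K F]

/-- The linear form `(s, t) ↦ s - θ t`. -/
noncomputable def lin (K : Type*) {F : Type*} [Field K] [Field F] [Algebra K F] (θ : F) :
    (Fin 2 → K) →ₗ[K] F :=
  (Algebra.linearMap K F).comp (LinearMap.proj 0) -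
    (LinearMap.mulLeft K θ).comp ((Algebra.linearMap K F).comp (LinearMap.proj 1))

theorem lin_apply (θ : F) (y : Fin 2 → K) :
    lin K θ y = algebraMap K F (y 0) - θ * algebraMap K F (y 1) := rfl

theorem algHom_lin (τ : F →ₐ[K] F) (θ : F) (y : Fin 2 → K) : τ (lin K θ y) = lin K (τ θ) y := by
  simp [lin_apply]

variable [Finite K] (h3 : Module.finrank K F = 3) {θ : F} (hθ : θ ∉ Set.range (algebraMap K F))
include h3 hθ

theorem lin_injective : Function.Injective (lin K θ) := by
  rw [injective_iff_map_eq_zero]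
  intro y hy
  have := linear_coeffs_eq_zero h3 hθ hy
  funext i
  fin_cases i
  exacts [this.1, this.2]

theorem lin_ne_zero {y : Fin 2 → K} (hy : y ≠ 0) : lin K θ y ≠ 0 := fun h =>
  hy (lin_injective h3 hθ (h.trans (map_zero _).symm))

theorem finrank_range_lin : Module.finrank K (LinearMap.range (lin K θ)) = 2 := by
  rw [LinearMap.finrank_range_of_inj (lin_injective h3 hθ), Module.finrank_fin_fun]

end LinearForms

/-! ### Normal form and tangents of special conics. -/

section SpecialConics

variable {K F : Type*} [Field K] [Finite K] [Field F] [Algebra K F]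
  {b : Module.Basis (Fin 3) K F} {t : F × F × F} {ρ φ : F} {C : NormalCurve K (V7 K) 2}

/-- The conic `(s, t) ↦ ρ (s - φ^q t)(s - φ^{q²} t)` in the spread element of `t`. -/
def IsConicForm (b : Module.Basis (Fin 3) K F) (t : F × F × F) (ρ φ : F)
    (C : NormalCurve K (V7 K) 2) : Prop :=
  C.frame 0 = emb b t ρ ∧
  C.frame 1 = emb b t (-(ρ * (frob K F φ + frob K F (frob K F φ)))) ∧
  C.frame 2 = emb b t (ρ * (frob K F φ * frob K F (frob K F φ)))

/-- The product of two conjugates of a form is its norm divided by the form itself. As the norm is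
in `K`, the point is `σ((ρ / f) t)` up to a scalar. -/
theorem IsConicForm.vec_eq (hC : IsConicForm b t ρ φ C) (y : Fin 2 → K) :
    C.vec y = emb b t (ρ * (frob K F (lin K φ y) * frob K F (frob K F (lin K φ y)))) := by
  rw [NormalCurve.vec_two, hC.1, hC.2.1, hC.2.2]
  simp only [← map_smul (emb b t), ← map_add (emb b t)]
  congr 1
  simp only [algHom_lin]
  simp only [lin_apply, Algebra.smul_def, map_mul, map_pow]
  ring

theorem IsConicForm.dvec_eq (hC : IsConicForm b t ρ φ C) (y u : Fin 2 → K) :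
    C.dvec y u = emb b t (ρ * (frob K F (lin K φ u) * frob K F (frob K F (lin K φ y)) +
      frob K F (lin K φ y) * frob K F (frob K F (lin K φ u)))) := by
  rw [NormalCurve.dvec_two, hC.1, hC.2.1, hC.2.2]
  simp only [← map_smul (emb b t), ← map_add (emb b t)]
  congr 1
  simp only [algHom_lin]
  simp only [lin_apply, Algebra.smul_def, map_mul, map_add, map_ofNat]
  ring

theorem IsConicForm.th_vec (ht : t ∈ lineInf F) (hC : IsConicForm b t ρ φ C) (τ : F →ₐ[K] F)
    (y : Fin 2 → F) : th b τ ((C.extend b).vec y) =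
      (τ ρ * ((y 0 - τ (frob K F φ) * y 1) * (y 0 - τ (frob K F (frob K F φ)) * y 1))) •
        tri τ t := by
  rw [NormalCurve.vec_two]
  simp only [NormalCurve.extend, hC.1, hC.2.1, hC.2.2, map_add, map_smul, th_ext, sigmaInv_emb ht,
    tri_smul, smul_smul, map_neg, map_mul]
  module

theorem IsConicForm.frame_mem (ht : t ∈ lineInf F) (ht0 : t ≠ 0) (hC : IsConicForm b t ρ φ C)
    (i : Fin 3) : C.frame i ∈ bb b (Projectivization.mk F t ht0) := by
  fin_cases i
  · exact hC.1 ▸ emb_mem_bb ht ht0 _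
  · exact hC.2.1 ▸ emb_mem_bb ht ht0 _
  · exact hC.2.2 ▸ emb_mem_bb ht ht0 _

/-- The sum is the trace of `g e^q e^{q²}`. It is needed as the derivative of the norm at `e` in the
direction `g`. -/
theorem frob_trace_mem_range (h3 : Module.finrank K F = 3) (e g : F) :
    g * frob K F e * frob K F (frob K F e) + e * frob K F g * frob K F (frob K F e) +
      e * frob K F e * frob K F (frob K F g) ∈ Set.range (algebraMap K F) := by
  apply mem_range_of_frob_eq h3
  simp only [map_add, map_mul, frob_frob_frob h3]
  ring

/-- The derivative of `ρ / f` in the direction `u` is `-ρ f(u) / f²`, and `ρ / f` is `(ρ / f²) f`.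
So the tangent is `ρ / f²` times the space of values of `f`. The norm `k` and its derivative `m`
translate between this and the polynomial parametrisation. -/
theorem IsConicForm.tangentLine_eq (hφ : φ ∉ Set.range (algebraMap K F))
    (hC : IsConicForm b t ρ φ C) (x : ℙ K (Fin 2 → K)) :
    C.tangentLine x =
      ((ρ / lin K φ x.rep ^ 2) • LinearMap.range (lin K φ)).map (emb b t) := by
  have h3 := finrank_eq_three b
  have he := lin_ne_zero h3 hφ x.rep_nonzero
  obtain ⟨k, hk⟩ := norm_mem_range h3 (lin K φ x.rep)
  have hk0 : k ≠ 0 := by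
    rintro rfl
    rw [map_zero, eq_comm] at hk
    simp [he] at hk
  ext v
  rw [NormalCurve.mem_tangentLine, Submodule.mem_map]
  have key : ∀ (a m : K) (u : Fin 2 → K), algebraMap K F m =
      lin K φ u * frob K F (lin K φ x.rep) * frob K F (frob K F (lin K φ x.rep)) +
      lin K φ x.rep * frob K F (lin K φ u) * frob K F (frob K F (lin K φ x.rep)) +
      lin K φ x.rep * frob K F (lin K φ x.rep) * frob K F (frob K F (lin K φ u)) →
      a • C.vec x.rep + C.dvec x.rep u =
        emb b t ((ρ / lin K φ x.rep ^ 2) • lin K φ ((a * k + m) • x.rep - k • u)) := by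
    intro a m u hm
    rw [hC.vec_eq, hC.dvec_eq, ← map_smul (emb b t), ← map_add (emb b t)]
    congr 1
    rw [map_sub, map_smul, map_smul]
    simp only [Algebra.smul_def (R := K), smul_eq_mul, map_add, map_mul, hk, hm]
    field_simp
    ring
  constructor
  · rintro ⟨a, u, rfl⟩
    obtain ⟨m, hm⟩ := frob_trace_mem_range h3 (lin K φ x.rep) (lin K φ u)
    exact ⟨_, Submodule.smul_mem_pointwise_smul _ _ _ ⟨_, rfl⟩, (key a m u hm).symm⟩
  · rintro ⟨_, hz, rfl⟩
    obtain ⟨_, ⟨y, rfl⟩, rfl⟩ := (Submodule.mem_smul_pointwise_iff_exists _ _ _).1 hz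
    obtain ⟨m, hm⟩ := frob_trace_mem_range h3 (lin K φ x.rep) (lin K φ (-(k⁻¹ • y)))
    refine ⟨-m / k, -(k⁻¹ • y), ?_⟩
    rw [key _ m _ hm]
    congr 3
    rw [div_mul_cancel₀ _ hk0, neg_add_cancel, zero_smul, zero_sub, smul_neg, neg_neg,
      smul_inv_smul₀ hk0]

theorem exists_isConicForm (hφ : φ ∉ Set.range (algebraMap K F)) (hρ : ρ ≠ 0)
    (ht : t ∈ lineInf F) (ht0 : t ≠ 0) : ∃ C, IsConicForm b t ρ φ C := by
  have h3 := finrank_eq_three b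
  refine ⟨⟨![emb b t ρ, emb b t (-(ρ * (frob K F φ + frob K F (frob K F φ)))),
    emb b t (ρ * (frob K F φ * frob K F (frob K F φ)))], ?_⟩, rfl, rfl, rfl⟩
  rw [Fintype.linearIndependent_iff]
  intro g hg
  replace hg := (Fin.sum_univ_three _).symm.trans hg
  simp only [Matrix.cons_val, ← map_smul (emb b t), ← map_add (emb b t)] at hg
  replace hg := emb_injective ht ht0 (hg.trans (map_zero _).symm)
  simp only [Algebra.smul_def] at hg
  have e1 : algebraMap K F (g 0) - algebraMap K F (g 1) * (frob K F φ + frob K F (frob K F φ)) +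
      algebraMap K F (g 2) * (frob K F φ * frob K F (frob K F φ)) = 0 := by
    apply mul_left_cancel₀ hρ
    linear_combination hg
  have e2 := congrArg (frob K F) e1
  simp only [map_add, map_sub, map_mul, AlgHom.commutes, map_zero, frob_frob_frob h3] at e2
  have n1 := sub_ne_zero.2 (frob_ne h3 hφ)
  -- The difference of the relation and its conjugate is divisible by `φ^q - φ`, and the quotient is
  -- linear in `φ^{q²}` over `K`.
  have e3 : algebraMap K F (g 1) - frob K F (frob K F φ) * algebraMap K F (g 2) = 0 := by
    apply mul_left_cancel₀ n1
    linear_combination e2 - e1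
  have hφ2 := algHom_notMem_range (frob K F) (algHom_notMem_range (frob K F) hφ)
  obtain ⟨g1, g2⟩ := linear_coeffs_eq_zero h3 hφ2 e3
  rw [g1, g2] at e1
  intro i
  fin_cases i
  exacts [by simpa using e1, g1, g2]

theorem vec_ne_zero_of_pair (φ : F) : (![φ, 1] : Fin 2 → F) ≠ 0 := fun h => by
  simpa using congrFun h 1

/-- In each of the two other coordinate maps, one factor of the conjugated form vanishes at `τ φ`.
-/
theorem IsConicForm.vec_mem_transversal (ht : t ∈ lineInf F) (hC : IsConicForm b t ρ φ C)
    (τ : F →ₐ[K] F) : (C.extend b).vec ![τ φ, 1] ∈ transversal b τ := by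
  have h3 := finrank_eq_three b
  refine mem_transversal.2 ⟨?_, ?_⟩ <;> rw [hC.th_vec ht]
  · simp [AlgHom.mul_apply, map_frob, frob_frob_frob h3]
  · simp [AlgHom.mul_apply, map_frob, frob_frob_frob h3]

theorem IsConicForm.isSpecialConic (ht : t ∈ lineInf F) (ht0 : t ≠ 0)
    (hC : IsConicForm b t ρ φ C) : IsSpecialConic b (Projectivization.mk F t ht0) C := by
  refine ⟨fun i => hC.frame_mem ht ht0 i, fun g hg => ?_⟩
  obtain ⟨τ, rfl⟩ := hg.exists_eq
  refine ⟨_, ⟨Projectivization.mk F ![τ φ, 1] (vec_ne_zero_of_pair _), rfl⟩, ?_⟩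
  rw [NormalCurve.point_mk, Projectivization.submodule_mk, Submodule.span_singleton_le_iff_mem]
  exact hC.vec_mem_transversal ht τ

theorem exists_vec_mem_transversal_one {n : ℕ} {N : NormalCurve K (V7 K) n}
    (hN : MeetsTransversals b N) :
    ∃ p : Fin 2 → F, p ≠ 0 ∧ (N.extend b).vec p ∈ transversal b 1 := by
  obtain ⟨_, ⟨x, rfl⟩, hx⟩ := hN _ (isTransversal_transversal_one b)
  rw [NormalCurve.point_eq_mk_rep, Projectivization.submodule_mk,
    Submodule.span_singleton_le_iff_mem] at hx
  exact ⟨_, x.rep_nonzero, hx⟩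

/-- The conic is a binary quadratic form with coefficients `c i` in `F`. At a point on a
transversal, its two nontrivial conjugates vanish at the parameter `φ`. Conjugating back, the form
itself has the roots `φ^q` and `φ^{q²}`, which determines it up to a factor. -/
theorem IsSpecialConic.exists_isConicForm (ht : t ∈ lineInf F) (ht0 : t ≠ 0)
    (hC : IsSpecialConic b (Projectivization.mk F t ht0) C) :
    ∃ ρ φ, ρ ≠ 0 ∧ φ ∉ Set.range (algebraMap K F) ∧ IsConicForm b t ρ φ C := by
  have h3 := finrank_eq_three b
  obtain ⟨hT, hmeet⟩ := hC
  simp only [bb_eq_range ht, LinearMap.mem_range] at hT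
  choose c hc using hT
  obtain ⟨p, hp0, hp⟩ := exists_vec_mem_transversal_one hmeet
  have hth : ∀ τ : F →ₐ[K] F, th b τ ((C.extend b).vec p) =
      (p 0 ^ 2 * τ (c 0) + p 0 * p 1 * τ (c 1) + p 1 ^ 2 * τ (c 2)) • tri τ t := by
    intro τ
    rw [NormalCurve.vec_two]
    simp only [NormalCurve.extend, ← hc, map_add, map_smul, th_ext, sigmaInv_emb ht,
      tri_smul, smul_smul, ← add_smul]
  obtain ⟨m1, m2⟩ := mem_transversal.1 hp
  have m0 : th b 1 ((C.extend b).vec p) ≠ 0 := fun h =>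
    (C.extend b).vec_ne_zero hp0 (th_eq_zero b 1 h m1 m2)
  have htri : ∀ τ : F →ₐ[K] F, tri τ t ≠ 0 := fun τ h => ht0 (tri_eq_zero.1 h)
  rw [hth, smul_eq_zero_iff_left (htri _)] at m1 m2
  rw [hth, ne_eq, smul_eq_zero_iff_left (htri _)] at m0
  simp only [mul_one, AlgHom.mul_apply, AlgHom.one_apply] at m0 m1 m2
  have hp1 : p 1 ≠ 0 := by
    intro h
    have hp00 : p 0 ≠ 0 := fun h0 => hp0 (funext fun i => by fin_cases i <;> assumption)
    have : c 0 = 0 := by simpa [h, hp00] using m1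
    simp [h, this] at m0
  set φ := p 0 / p 1 with hφdef
  have hp0φ : p 0 = φ * p 1 := by rw [hφdef, div_mul_cancel₀ _ hp1]
  rw [hp0φ] at m0 m1 m2
  have q0 : φ ^ 2 * c 0 + φ * c 1 + c 2 ≠ 0 := fun h => m0 (by linear_combination p 1 ^ 2 * h)
  have q1 : φ ^ 2 * frob K F (c 0) + φ * frob K F (c 1) + frob K F (c 2) = 0 := by
    apply mul_left_cancel₀ (pow_ne_zero 2 hp1)
    linear_combination m1
  have q2 : φ ^ 2 * frob K F (frob K F (c 0)) + φ * frob K F (frob K F (c 1)) +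
      frob K F (frob K F (c 2)) = 0 := by
    apply mul_left_cancel₀ (pow_ne_zero 2 hp1)
    linear_combination m2
  replace q1 := congrArg (frob K F) (congrArg (frob K F) q1)
  replace q2 := congrArg (frob K F) q2
  simp only [map_add, map_mul, map_pow, map_zero, frob_frob_frob h3] at q1 q2
  -- For `φ` in `K` the root `φ^q` would be `φ`, where the form does not vanish by `q0`.
  have hφ : φ ∉ Set.range (algebraMap K F) := by
    rintro ⟨k, hk⟩
    apply q0
    rw [← hk] at q2 ⊢
    rwa [AlgHom.commutes] at q2
  have n3 : frob K F (frob K F φ) - frob K F φ ≠ 0 :=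
    sub_ne_zero.2 fun h => frob_ne h3 hφ (frob_injective h)
  have c1 : c 1 = -(c 0 * (frob K F φ + frob K F (frob K F φ))) := by
    apply mul_left_cancel₀ n3
    linear_combination q1 - q2
  have c2 : c 2 = c 0 * (frob K F φ * frob K F (frob K F φ)) := by
    rw [c1] at q2
    linear_combination q2
  have c0 : c 0 ≠ 0 := by
    intro h
    apply q0
    rw [c1, c2, h]
    ring
  exact ⟨c 0, φ, c0, hφ, (hc 0).symm, by rw [← c1, hc], by rw [← c2, hc]⟩

end SpecialConics

/-! ### Normal form and shadow points of special twisted cubics. -/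

section SpecialCubics

variable {K F : Type*} [Field K] [Finite K] [Field F] [Algebra K F]
  {b : Module.Basis (Fin 3) K F} {l : F × F × F} {A : V7 K} {l₀ l₁ θ : F}
  {N : NormalCurve K (V7 K) 3}

/-- The twisted cubic
`(s, t) ↦ (s - θ^q t)(s - θ^{q²} t)(l₀ s + l₁ t) l + (s - θ t)(s - θ^q t)(s - θ^{q²} t) A`. -/
def IsCubicForm (b : Module.Basis (Fin 3) K F) (l : F × F × F) (A : V7 K) (l₀ l₁ θ : F)
    (N : NormalCurve K (V7 K) 3) : Prop :=
  ∃ ζ₁ ζ₂ ζ₃ : K,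
    algebraMap K F ζ₁ = -(θ + frob K F θ + frob K F (frob K F θ)) ∧
    algebraMap K F ζ₂ = θ * frob K F θ + θ * frob K F (frob K F θ) +
      frob K F θ * frob K F (frob K F θ) ∧
    algebraMap K F ζ₃ = -(θ * frob K F θ * frob K F (frob K F θ)) ∧
    N.frame 0 = emb b l l₀ + A ∧
    N.frame 1 = emb b l (l₁ - l₀ * (frob K F θ + frob K F (frob K F θ))) + ζ₁ • A ∧
    N.frame 2 = emb b l (l₀ * (frob K F θ * frob K F (frob K F θ)) -
      l₁ * (frob K F θ + frob K F (frob K F θ))) + ζ₂ • A ∧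
    N.frame 3 = emb b l (l₁ * (frob K F θ * frob K F (frob K F θ))) + ζ₃ • A

/-- The coefficient `m` of `A` is the norm of the form `e`. Division by it gives the affine shape `A
+ σ(((l₀ y₀ + l₁ y₁) / e) l)`. -/
theorem IsCubicForm.vec_eq (hN : IsCubicForm b l A l₀ l₁ θ N) (y : Fin 2 → K) {m : K}
    (hm : algebraMap K F m = lin K θ y * frob K F (lin K θ y) * frob K F (frob K F (lin K θ y))) :
    N.vec y = emb b l (frob K F (lin K θ y) * frob K F (frob K F (lin K θ y)) *
      (l₀ * algebraMap K F (y 0) + l₁ * algebraMap K F (y 1))) + m • A := by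
  obtain ⟨ζ₁, ζ₂, ζ₃, z1, z2, z3, f0, f1, f2, f3⟩ := hN
  have hm' : m = y 0 ^ 3 + y 0 ^ 2 * y 1 * ζ₁ + y 0 * y 1 ^ 2 * ζ₂ + y 1 ^ 3 * ζ₃ := by
    apply (algebraMap K F).injective
    rw [hm]
    simp only [algHom_lin]
    simp only [lin_apply, map_add, map_mul, map_pow, z1, z2, z3]
    ring
  have key : ∀ (k0 k1 k2 k3 : K) (a0 a1 a2 a3 : F),
      k0 • (emb b l a0 + A) + k1 • (emb b l a1 + ζ₁ • A) + k2 • (emb b l a2 + ζ₂ • A) +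
        k3 • (emb b l a3 + ζ₃ • A) = emb b l (k0 • a0 + k1 • a1 + k2 • a2 + k3 • a3) +
        (k0 + k1 * ζ₁ + k2 * ζ₂ + k3 * ζ₃) • A := by
    intros
    simp only [map_add, map_smul]
    module
  rw [NormalCurve.vec_three, f0, f1, f2, f3, key, ← hm']
  congr 2
  simp only [algHom_lin]
  simp only [lin_apply, Algebra.smul_def, map_mul, map_pow]
  ring

theorem IsCubicForm.dvec_eq (hN : IsCubicForm b l A l₀ l₁ θ N) (y u : Fin 2 → K) {m : K}
    (hm : algebraMap K F m =
      lin K θ u * frob K F (lin K θ y) * frob K F (frob K F (lin K θ y)) +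
      lin K θ y * frob K F (lin K θ u) * frob K F (frob K F (lin K θ y)) +
      lin K θ y * frob K F (lin K θ y) * frob K F (frob K F (lin K θ u))) :
    N.dvec y u = emb b l
      ((frob K F (lin K θ u) * frob K F (frob K F (lin K θ y)) +
        frob K F (lin K θ y) * frob K F (frob K F (lin K θ u))) *
        (l₀ * algebraMap K F (y 0) + l₁ * algebraMap K F (y 1)) +
      frob K F (lin K θ y) * frob K F (frob K F (lin K θ y)) *
      (l₀ * algebraMap K F (u 0) + l₁ * algebraMap K F (u 1))) + m • A := by
  obtain ⟨ζ₁, ζ₂, ζ₃, z1, z2, z3, f0, f1, f2, f3⟩ := hN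
  have hm' : m = 3 * u 0 * y 0 ^ 2 + (2 * u 0 * y 0 * y 1 + u 1 * y 0 ^ 2) * ζ₁ +
      (u 0 * y 1 ^ 2 + 2 * u 1 * y 0 * y 1) * ζ₂ + 3 * u 1 * y 1 ^ 2 * ζ₃ := by
    apply (algebraMap K F).injective
    rw [hm]
    simp only [algHom_lin]
    simp only [lin_apply, map_add, map_mul, map_pow, map_ofNat, z1, z2, z3]
    ring
  have key : ∀ (k0 k1 k2 k3 : K) (a0 a1 a2 a3 : F),
      k0 • (emb b l a0 + A) + k1 • (emb b l a1 + ζ₁ • A) + k2 • (emb b l a2 + ζ₂ • A) +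
        k3 • (emb b l a3 + ζ₃ • A) = emb b l (k0 • a0 + k1 • a1 + k2 • a2 + k3 • a3) +
        (k0 + k1 * ζ₁ + k2 * ζ₂ + k3 * ζ₃) • A := by
    intros
    simp only [map_add, map_smul]
    module
  rw [NormalCurve.dvec_three, f0, f1, f2, f3, key, ← hm']
  congr 2
  simp only [algHom_lin]
  simp only [lin_apply, Algebra.smul_def, map_mul, map_pow, map_add, map_ofNat]
  ring

theorem IsCubicForm.th_vec (hl : l ∈ lineInf F) (hN : IsCubicForm b l A l₀ l₁ θ N)
    (τ : F →ₐ[K] F) (y : Fin 2 → F) : th b τ ((N.extend b).vec y) =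
      ((y 0 - τ (frob K F θ) * y 1) * (y 0 - τ (frob K F (frob K F θ)) * y 1) *
        (τ l₀ * y 0 + τ l₁ * y 1)) • tri τ l +
      ((y 0 - τ θ * y 1) * (y 0 - τ (frob K F θ) * y 1) *
        (y 0 - τ (frob K F (frob K F θ)) * y 1)) • tri τ (sigmaInv b A) := by
  obtain ⟨ζ₁, ζ₂, ζ₃, z1, z2, z3, f0, f1, f2, f3⟩ := hN
  replace z1 := congrArg τ z1
  replace z2 := congrArg τ z2
  replace z3 := congrArg τ z3
  simp only [map_add, map_mul, map_neg, AlgHom.commutes] at z1 z2 z3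
  rw [NormalCurve.vec_three]
  simp only [NormalCurve.extend]
  rw [f0, f1, f2, f3]
  simp only [map_add (th b τ), map_smul (th b τ), th_ext]
  simp only [map_add (sigmaInv b), map_smul (sigmaInv b), sigmaInv_emb hl, tri_smul, tri_add,
    smul_eq_algebraMap_smul (K := K) (F := F) (V := F × F × F), AlgHom.commutes]
  simp only [z1, z2, z3, map_add, map_sub, map_mul]
  module

/-- In the affine shape this is the derivative of a quotient of two linear forms: their Wronskian
over `e²`. The Wronskian is the constant `l₀ θ + l₁` times the determinant of the parameter and the
direction. -/
theorem IsCubicForm.tangentLine_inf_bb (hl : l ∈ lineInf F) (hl0 : l ≠ 0) (hA : A.2.2 ≠ 0)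
    (hθ : θ ∉ Set.range (algebraMap K F)) (hN : IsCubicForm b l A l₀ l₁ θ N)
    (x : ℙ K (Fin 2 → K)) :
    N.tangentLine x ⊓ bb b (Projectivization.mk F l hl0) =
      K ∙ emb b l ((l₀ * θ + l₁) / lin K θ x.rep ^ 2) := by
  have h3 := finrank_eq_three b
  have he := lin_ne_zero h3 hθ x.rep_nonzero
  obtain ⟨m, hm⟩ := norm_mem_range h3 (lin K θ x.rep)
  have hm0 : m ≠ 0 := by
    rintro rfl
    rw [map_zero, eq_comm] at hm
    simp [he] at hm
  have key : ∀ (a m' : K) (u : Fin 2 → K), algebraMap K F m' =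
      lin K θ u * frob K F (lin K θ x.rep) * frob K F (frob K F (lin K θ x.rep)) +
      lin K θ x.rep * frob K F (lin K θ u) * frob K F (frob K F (lin K θ x.rep)) +
      lin K θ x.rep * frob K F (lin K θ x.rep) * frob K F (frob K F (lin K θ u)) →
      a * m + m' = 0 → a • N.vec x.rep + N.dvec x.rep u =
        (m * (x.rep 0 * u 1 - x.rep 1 * u 0)) •
          emb b l ((l₀ * θ + l₁) / lin K θ x.rep ^ 2) := by
    intro a m' u hm' ha
    rw [hN.vec_eq _ hm, hN.dvec_eq _ _ hm', smul_add, add_add_add_comm, smul_smul, ← add_smul, ha,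
      zero_smul, add_zero, ← map_smul (emb b l), ← map_smul (emb b l), ← map_add (emb b l)]
    congr 1
    have ha' := congrArg (algebraMap K F) ha
    simp only [map_add, map_mul, map_zero, hm, hm'] at ha'
    simp only [Algebra.smul_def, map_mul, map_sub, hm]
    field_simp
    have e1 : lin K θ x.rep = algebraMap K F (x.rep 0) - θ * algebraMap K F (x.rep 1) := rfl
    have e2 : lin K θ u = algebraMap K F (u 0) - θ * algebraMap K F (u 1) := rfl
    generalize frob K F (lin K θ x.rep) = X1 at *
    generalize frob K F (frob K F (lin K θ u)) = U2 at *
    generalize frob K F (lin K θ u) = U1 at *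
    generalize frob K F X1 = X2 at *
    generalize lin K θ x.rep = X at *
    generalize lin K θ u = U at *
    generalize algebraMap K F (x.rep 0) = x0 at *
    generalize algebraMap K F (x.rep 1) = x1 at *
    generalize algebraMap K F (u 0) = u0 at *
    generalize algebraMap K F (u 1) = u1 at *
    -- The Wronskian identity. The hypothesis `ha'` says that the multiples of `A` cancel.
    have e3 : X * (l₀ * u0 + l₁ * u1) - (l₀ * x0 + l₁ * x1) * U =
        (l₀ * θ + l₁) * (x0 * u1 - x1 * u0) := by
      rw [e1, e2]
      ring
    linear_combination (l₀ * x0 + l₁ * x1) * ha' + X1 * X2 * e3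
  ext v
  rw [Submodule.mem_inf, NormalCurve.mem_tangentLine, Submodule.mem_span_singleton]
  constructor
  · rintro ⟨⟨a, u, rfl⟩, hv⟩
    obtain ⟨m', hm'⟩ := frob_trace_mem_range h3 (lin K θ x.rep) (lin K θ u)
    refine ⟨_, (key a m' u hm' ?_).symm⟩
    rw [bb_eq_range hl, LinearMap.mem_range] at hv
    obtain ⟨c, hc⟩ := hv
    rw [hN.vec_eq _ hm, hN.dvec_eq _ _ hm'] at hc
    have := congrArg (fun v => v.2.2) hc
    simp only [Prod.snd_add, Prod.smul_snd, emb_snd_snd, smul_eq_mul, zero_add] at this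
    apply mul_right_cancel₀ hA
    linear_combination -this
  · rintro ⟨c, rfl⟩
    -- Any determinant can be reached by a choice of direction, so every multiple of the shadow
    -- vector is on the tangent.
    obtain ⟨u, hu⟩ : ∃ u : Fin 2 → K, x.rep 0 * u 1 - x.rep 1 * u 0 = c / m := by
      by_cases h0 : x.rep 0 = 0
      · have h1 : x.rep 1 ≠ 0 := fun h1 =>
          x.rep_nonzero (funext fun i => by fin_cases i <;> assumption)
        refine ⟨![-(c / m) / x.rep 1, 0], ?_⟩
        simp only [Matrix.cons_val]
        field_simp
        ring
      · refine ⟨![0, (c / m) / x.rep 0], ?_⟩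
        simp only [Matrix.cons_val]
        field_simp
        ring
    obtain ⟨m', hm'⟩ := frob_trace_mem_range h3 (lin K θ x.rep) (lin K θ u)
    refine ⟨⟨-m' / m, u, ?_⟩, Submodule.smul_mem _ _ (emb_mem_bb hl hl0 _)⟩
    rw [key _ m' u hm' (by field_simp; ring), hu, mul_div_cancel₀ _ hm0]

/-- The last coordinate is a cubic form over `K`. It vanishes at the parameter `θ` of a point on a
transversal, so it is a multiple of the norm form. At `θ` only the `l`-component is left, and as for
conics its form has the roots `θ^q` and `θ^{q²}`. The remaining linear factor does not vanish at
`θ`. -/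
theorem IsSpecialTwistedCubic.exists_isCubicForm (hl : l ∈ lineInf F) (hl0 : l ≠ 0)
    (hN : IsSpecialTwistedCubic b (Projectivization.mk F l hl0) N) :
    ∃ (A : V7 K) (l₀ l₁ θ : F), A.2.2 ≠ 0 ∧ θ ∉ Set.range (algebraMap K F) ∧
      l₀ * θ + l₁ ≠ 0 ∧ IsCubicForm b l A l₀ l₁ θ N := by
  have h3 := finrank_eq_three b
  obtain ⟨hle, hnle, hmeet⟩ := hN
  obtain ⟨A, hAmem, hA⟩ : ∃ A ∈ Submodule.span K (Set.range N.frame), A.2.2 ≠ 0 := by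
    by_contra! h
    exact hnle fun v hv => mem_sigmaInf.2 (h v hv)
  have hA0 : A ≠ 0 := by
    rintro rfl
    exact hA rfl
  have hspan : bb b (Projectivization.mk F l hl0) ⊔ (K ∙ A) =
      Submodule.span K (Set.range N.frame) := by
    apply Submodule.eq_of_le_of_finrank_eq
    · exact sup_le hle ((Submodule.span_singleton_le_iff_mem _ _).2 hAmem)
    · have h1 := Submodule.finrank_sup_add_finrank_inf_eq (bb b (Projectivization.mk F l hl0))
        (K ∙ A)
      have h2 : bb b (Projectivization.mk F l hl0) ⊓ (K ∙ A) = ⊥ := by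
        rw [eq_bot_iff]
        rintro v ⟨hv1, hv2⟩
        obtain ⟨k, rfl⟩ := Submodule.mem_span_singleton.1 hv2
        rw [SetLike.mem_coe, bb_eq_range hl] at hv1
        obtain ⟨c, hc⟩ := hv1
        have := congrArg (fun v => v.2.2) hc
        simp only [emb_snd_snd, Prod.smul_snd, smul_eq_mul] at this
        have hk : k = 0 := (mul_eq_zero.1 this.symm).resolve_right hA
        simp [hk]
      rw [h2, finrank_bot, finrank_bb hl, finrank_span_singleton hA0] at h1
      rw [finrank_span_eq_card N.indep, Fintype.card_fin]
      omega
  have hframe : ∀ i, ∃ (c : F) (z : K), N.frame i = emb b l c + z • A := by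
    intro i
    have : N.frame i ∈ Submodule.span K (Set.range N.frame) :=
      Submodule.subset_span (Set.mem_range_self i)
    rw [← hspan, bb_eq_range hl, Submodule.mem_sup] at this
    obtain ⟨_, ⟨c, rfl⟩, _, hz, e⟩ := this
    obtain ⟨z, rfl⟩ := Submodule.mem_span_singleton.1 hz
    exact ⟨c, z, e.symm⟩
  choose c z hcz using hframe
  obtain ⟨p, hp0, hp⟩ := exists_vec_mem_transversal_one hmeet
  have hth : ∀ τ : F →ₐ[K] F, th b τ ((N.extend b).vec p) =
      (p 0 ^ 3 * τ (c 0) + p 0 ^ 2 * p 1 * τ (c 1) + p 0 * p 1 ^ 2 * τ (c 2) +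
        p 1 ^ 3 * τ (c 3)) • tri τ l + (p 0 ^ 3 * algebraMap K F (z 0) +
        p 0 ^ 2 * p 1 * algebraMap K F (z 1) + p 0 * p 1 ^ 2 * algebraMap K F (z 2) +
        p 1 ^ 3 * algebraMap K F (z 3)) • tri τ (sigmaInv b A) := by
    intro τ
    rw [NormalCurve.vec_three]
    simp only [NormalCurve.extend, hcz, map_add (th b τ), map_smul (th b τ), th_ext]
    simp only [map_add (sigmaInv b), map_smul (sigmaInv b), sigmaInv_emb hl, tri_smul, tri_add,
      smul_eq_algebraMap_smul (K := K) (F := F) (V := F × F × F), AlgHom.commutes]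
    module
  have hZ : p 0 ^ 3 * algebraMap K F (z 0) + p 0 ^ 2 * p 1 * algebraMap K F (z 1) +
      p 0 * p 1 ^ 2 * algebraMap K F (z 2) + p 1 ^ 3 * algebraMap K F (z 3) = 0 := by
    have h1 := (hth 1).symm.trans (th_apply b 1 _)
    have h2 := congrArg (fun v => v.2.2) h1
    simp only [snd_snd_of_mem_transversal hp, tri, Prod.snd_add, Prod.smul_snd, smul_eq_mul,
      mem_lineInf.1 hl, map_zero, mul_zero, zero_add, sigmaInv_snd_snd, AlgHom.one_apply] at h2
    exact (mul_eq_zero.1 h2).resolve_right (by simpa using hA)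
  obtain ⟨m1, m2⟩ := mem_transversal.1 hp
  have m0 : th b 1 ((N.extend b).vec p) ≠ 0 := fun h =>
    (N.extend b).vec_ne_zero hp0 (th_eq_zero b 1 h m1 m2)
  have htri : ∀ τ : F →ₐ[K] F, tri τ l ≠ 0 := fun τ h => hl0 (tri_eq_zero.1 h)
  rw [hth, hZ, zero_smul, add_zero, smul_eq_zero_iff_left (htri _)] at m1 m2
  rw [hth, hZ, zero_smul, add_zero, ne_eq, smul_eq_zero_iff_left (htri _)] at m0
  simp only [mul_one, AlgHom.mul_apply, AlgHom.one_apply] at m0 m1 m2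
  have hp1 : p 1 ≠ 0 := by
    intro h
    have hp00 : p 0 ≠ 0 := fun h0 => hp0 (funext fun i => by fin_cases i <;> assumption)
    have : c 0 = 0 := by simpa [h, hp00] using m1
    simp [h, this] at m0
  set θ := p 0 / p 1 with hθdef
  have hp0θ : p 0 = θ * p 1 := by rw [hθdef, div_mul_cancel₀ _ hp1]
  rw [hp0θ] at m0 m1 m2 hZ
  have q0 : θ ^ 3 * c 0 + θ ^ 2 * c 1 + θ * c 2 + c 3 ≠ 0 := fun h =>
    m0 (by linear_combination p 1 ^ 3 * h)
  have q1 : θ ^ 3 * frob K F (c 0) + θ ^ 2 * frob K F (c 1) + θ * frob K F (c 2) +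
      frob K F (c 3) = 0 := by
    apply mul_left_cancel₀ (pow_ne_zero 3 hp1)
    linear_combination m1
  have q2 : θ ^ 3 * frob K F (frob K F (c 0)) + θ ^ 2 * frob K F (frob K F (c 1)) +
      θ * frob K F (frob K F (c 2)) + frob K F (frob K F (c 3)) = 0 := by
    apply mul_left_cancel₀ (pow_ne_zero 3 hp1)
    linear_combination m2
  have Z0 : θ ^ 3 * algebraMap K F (z 0) + θ ^ 2 * algebraMap K F (z 1) +
      θ * algebraMap K F (z 2) + algebraMap K F (z 3) = 0 := by
    apply mul_left_cancel₀ (pow_ne_zero 3 hp1)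
    linear_combination hZ
  have Z1 := congrArg (frob K F) Z0
  have Z2 := congrArg (frob K F) Z1
  replace q1 := congrArg (frob K F) (congrArg (frob K F) q1)
  replace q2 := congrArg (frob K F) q2
  simp only [map_add, map_mul, map_pow, map_zero, frob_frob_frob h3, AlgHom.commutes]
    at q1 q2 Z1 Z2
  have hθ : θ ∉ Set.range (algebraMap K F) := by
    rintro ⟨k, hk⟩
    apply q0
    rw [← hk] at q2 ⊢
    rwa [AlgHom.commutes] at q2
  have n1 := sub_ne_zero.2 (frob_ne h3 hθ)
  have n2 := sub_ne_zero.2 (frob_frob_ne h3 hθ)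
  have n3 : frob K F (frob K F θ) - frob K F θ ≠ 0 :=
    sub_ne_zero.2 fun h => frob_ne h3 hθ (frob_injective h)
  have ζ1 : algebraMap K F (z 1) =
      -(algebraMap K F (z 0) * (θ + frob K F θ + frob K F (frob K F θ))) := by
    have d1 : algebraMap K F (z 0) * (frob K F θ ^ 2 + frob K F θ * θ + θ ^ 2) +
        algebraMap K F (z 1) * (frob K F θ + θ) + algebraMap K F (z 2) = 0 := by
      apply mul_left_cancel₀ n1
      linear_combination Z1 - Z0
    have d2 : algebraMap K F (z 0) *
        (frob K F (frob K F θ) ^ 2 + frob K F (frob K F θ) * θ + θ ^ 2) +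
        algebraMap K F (z 1) * (frob K F (frob K F θ) + θ) + algebraMap K F (z 2) = 0 := by
      apply mul_left_cancel₀ n2
      linear_combination Z2 - Z0
    apply mul_left_cancel₀ n3
    linear_combination d2 - d1
  have ζ2 : algebraMap K F (z 2) = algebraMap K F (z 0) * (θ * frob K F θ +
      θ * frob K F (frob K F θ) + frob K F θ * frob K F (frob K F θ)) := by
    rw [ζ1] at Z0 Z1
    apply mul_left_cancel₀ n1
    linear_combination Z1 - Z0
  have ζ3 : algebraMap K F (z 3) =
      -(algebraMap K F (z 0) * (θ * frob K F θ * frob K F (frob K F θ))) := by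
    rw [ζ1, ζ2] at Z0
    linear_combination Z0
  -- Otherwise the last coordinate would vanish identically and the 3-space would lie in `Σ∞`.
  have hz0 : z 0 ≠ 0 := by
    intro h
    have hz : ∀ i, z i = 0 := by
      rw [h, map_zero, zero_mul] at ζ1 ζ2 ζ3
      intro i
      fin_cases i
      exacts [h, by simpa using ζ1, by simpa using ζ2, by simpa using ζ3]
    apply hnle
    rw [Submodule.span_le]
    rintro _ ⟨i, rfl⟩
    rw [hcz, hz, zero_smul, add_zero]
    rfl
  have hz0' : algebraMap K F (z 0) ≠ 0 := (map_ne_zero _).2 hz0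
  have c2 : c 2 = c 0 * (frob K F θ * frob K F (frob K F θ)) -
      (c 1 + c 0 * (frob K F θ + frob K F (frob K F θ))) *
        (frob K F θ + frob K F (frob K F θ)) := by
    apply mul_left_cancel₀ n3
    linear_combination q1 - q2
  have c3 : c 3 = (c 1 + c 0 * (frob K F θ + frob K F (frob K F θ))) *
      (frob K F θ * frob K F (frob K F θ)) := by
    rw [c2] at q2
    linear_combination q2
  -- Rescaling `A` by `z 0` makes the norm form monic. The second coefficient of the linear factor
  -- comes from division by the quadratic with roots `θ^q`, `θ^{q²}`.
  refine ⟨z 0 • A, c 0, c 1 + c 0 * (frob K F θ + frob K F (frob K F θ)), θ, ?_, hθ, ?_,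
    z 1 / z 0, z 2 / z 0, z 3 / z 0, ?_, ?_, ?_, ?_, ?_, ?_, ?_⟩
  · simpa [hz0] using hA
  · intro h
    apply q0
    rw [c2, c3]
    linear_combination (θ - frob K F θ) * (θ - frob K F (frob K F θ)) * h
  · rw [map_div₀, ζ1]
    field_simp
  · rw [map_div₀, ζ2]
    field_simp
  · rw [map_div₀, ζ3]
    field_simp
  · rw [hcz]
  · rw [hcz, smul_smul, div_mul_cancel₀ _ hz0, add_sub_cancel_right]
  · rw [hcz, smul_smul, div_mul_cancel₀ _ hz0, ← c2]
  · rw [hcz, smul_smul, div_mul_cancel₀ _ hz0, ← c3]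

end SpecialCubics

/-! ### Matching the cover lines with the tangents of a conic. -/

section Matching

variable {K F : Type*} [Field K] [Field F] [Algebra K F]

theorem gl_smul_apply {R : Type*} [Field R] (B : GL (Fin 2) R) (y : Fin 2 → R) (i : Fin 2) :
    (B • y) i = B.1 i 0 * y 0 + B.1 i 1 * y 1 := by
  rw [Units.smul_def, Matrix.smul_eq_mulVec]
  simp [Matrix.mulVec, dotProduct, Fin.sum_univ_two]

theorem map_gl_smul_apply (B : GL (Fin 2) K) (y : Fin 2 → F) (i : Fin 2) :
    (Matrix.GeneralLinearGroup.map (algebraMap K F) B • y) i =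
      algebraMap K F (B.1 i 0) * y 0 + algebraMap K F (B.1 i 1) * y 1 := by
  rw [gl_smul_apply]
  rfl

theorem lin_gl_coeffs {B : GL (Fin 2) K} {θ φ ν : F}
    (h : ∀ y, lin K φ (B • y) = ν * lin K θ y) :
    algebraMap K F (B.1 0 0) - φ * algebraMap K F (B.1 1 0) = ν ∧
      algebraMap K F (B.1 0 1) - φ * algebraMap K F (B.1 1 1) = -(ν * θ) := by
  have h0 := h ![1, 0]
  have h1 := h ![0, 1]
  simp only [lin_apply, gl_smul_apply, Matrix.cons_val] at h0 h1
  simp only [mul_one, mul_zero, add_zero, zero_add, map_one, map_zero, sub_zero, zero_sub] at h0 h1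
  exact ⟨h0, by linear_combination h1⟩

/-- An identity of linear forms on `K²` is an identity of coefficients, so it persists for
parameters over `F` and under conjugation. -/
theorem map_gl_smul_sub {B : GL (Fin 2) K} {θ φ ν : F}
    (h : ∀ y, lin K φ (B • y) = ν * lin K θ y) (τ : F →ₐ[K] F) (y : Fin 2 → F) :
    (Matrix.GeneralLinearGroup.map (algebraMap K F) B • y) 0 -
      τ φ * (Matrix.GeneralLinearGroup.map (algebraMap K F) B • y) 1 =
      τ ν * (y 0 - τ θ * y 1) := by
  obtain ⟨h0, h1⟩ := lin_gl_coeffs h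
  replace h0 := congrArg τ h0
  replace h1 := congrArg τ h1
  simp only [map_sub, map_mul, map_neg, AlgHom.commutes] at h0 h1
  rw [map_gl_smul_apply, map_gl_smul_apply]
  linear_combination y 0 * h0 + y 1 * h1

variable [Finite K] (h3 : Module.finrank K F = 3) {θ φ : F}
  (hθ : θ ∉ Set.range (algebraMap K F)) (hφ : φ ∉ Set.range (algebraMap K F))

include h3 in
theorem div_mem_range_of_smul_eq {V : Submodule K F}
    (hV : Module.finrank K V = 2) {a c : F} (hc : c ≠ 0) (h : a • V = c • V) :
    a / c ∈ Set.range (algebraMap K F) := by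
  refine mem_range_of_smul_le h3 hV fun v hv => ?_
  have : a • v ∈ c • V := h ▸ Submodule.smul_mem_pointwise_smul v a V hv
  obtain ⟨w, hw, e⟩ := (Submodule.mem_smul_pointwise_iff_exists _ _ _).1 this
  have e' : a / c * v = w := by
    field_simp
    rw [smul_eq_mul, smul_eq_mul] at e
    rw [← e, mul_comm]
  rwa [e']

include h3 hθ

theorem exists_gl_lin_eq {ν : F} (hν : ν ≠ 0)
    (h : LinearMap.range (lin K φ) = ν • LinearMap.range (lin K θ)) :
    ∃ B : GL (Fin 2) K, ∀ y, lin K φ (B • y) = ν * lin K θ y := by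
  have hex : ∀ y : Fin 2 → K, ∃ z, lin K φ z = ν * lin K θ y := by
    intro y
    have : ν • lin K θ y ∈ LinearMap.range (lin K φ) := by
      rw [h]
      exact Submodule.smul_mem_pointwise_smul _ _ _ ⟨y, rfl⟩
    exact this
  obtain ⟨c, hc⟩ := hex ![1, 0]
  obtain ⟨d, hd⟩ := hex ![0, 1]
  -- The columns are the preimages of `ν` and `-ν θ` under the form with root `φ`.
  let M : Matrix (Fin 2) (Fin 2) K := Matrix.of fun i => ![c i, d i]
  have hM : ∀ y, M.mulVec y = y 0 • c + y 1 • d := by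
    intro y
    funext i
    simp [M, Matrix.mulVec, dotProduct, Fin.sum_univ_two, mul_comm]
  have hlin : ∀ y, lin K φ (M.mulVec y) = ν * lin K θ y := by
    intro y
    rw [hM, map_add, map_smul, map_smul, hc, hd]
    simp [lin_apply, Algebra.smul_def]
    ring
  have hdet : M.det ≠ 0 := by
    intro h0
    obtain ⟨y, hy0, hy⟩ := Matrix.exists_mulVec_eq_zero_iff.2 h0
    have := hlin y
    rw [hy, map_zero, eq_comm] at this
    exact lin_ne_zero h3 hθ hy0 ((mul_eq_zero.1 this).resolve_left hν)
  exact ⟨Matrix.GeneralLinearGroup.mkOfDetNeZero M hdet, hlin⟩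

include hφ in
/-- If the lines `(μ / (s - θ t)²) W` are tangents of the conic `ρ / (s - φ t)`, then up to a
change of parameter this conic is `μ κ / (s - θ t)`, where `W = κ ⟨1, θ⟩`. -/
theorem exists_matching {W : Submodule K F} {μ ρ κ : F} (hμ : μ ≠ 0) (hρ : ρ ≠ 0) (hκ : κ ≠ 0)
    (hW : W = κ • LinearMap.range (lin K θ))
    (h : ∀ x : ℙ K (Fin 2 → K), ∃ y : ℙ K (Fin 2 → K), (μ / lin K θ x.rep ^ 2) • W =
      (ρ / lin K φ y.rep ^ 2) • LinearMap.range (lin K φ)) :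
    ∃ (B : GL (Fin 2) K) (ν : F) (g : K), ν ≠ 0 ∧ g ≠ 0 ∧ ρ = algebraMap K F g * (μ * κ) * ν ∧
      ∀ y, lin K φ (B • y) = ν * lin K θ y := by
  have hV := finrank_range_lin h3 hθ
  obtain ⟨ν, hν, hνV⟩ := exists_smul_eq h3 hV (finrank_range_lin h3 hφ)
  obtain ⟨B, hB⟩ := exists_gl_lin_eq h3 hθ hν hνV
  -- Both lines are multiples of one plane `V`, and multipliers of `V` are determined up to `K`.
  -- With `w` the value of the `θ`-form and `ν w'` that of the `φ`-form, equality only says `γ w² ∈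
  -- K w'²`. No relation between the parameters `x` and `y` is known.
  have hγ : ρ / (μ * κ * ν) ∈ Set.range (algebraMap K F) := by
    refine mem_range_of_mul_sq h3 hV ?_
    rintro _ ⟨p, rfl⟩ hp
    have hp0 : p ≠ 0 := by
      rintro rfl
      exact hp (map_zero _)
    obtain ⟨u, hu⟩ := Projectivization.exists_smul_eq_mk_rep K p hp0
    obtain ⟨y, hy⟩ := h (Projectivization.mk K p hp0)
    rw [← hu, hW, hνV, smul_smul, smul_smul] at hy
    have hfy := lin_ne_zero h3 hφ y.rep_nonzero
    obtain ⟨w', hw', e⟩ := (Submodule.mem_smul_pointwise_iff_exists _ _ _).1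
      (hνV ▸ LinearMap.mem_range_self (lin K φ) y.rep)
    rw [← e, smul_eq_mul] at hy hfy
    have hw0 : w' ≠ 0 := right_ne_zero_of_mul hfy
    obtain ⟨k, hk⟩ := div_mem_range_of_smul_eq h3 hV (by
      exact mul_ne_zero (div_ne_zero hρ (pow_ne_zero 2 hfy)) hν) hy
    have hu0 : algebraMap K F u ≠ 0 := (map_ne_zero _).2 u.ne_zero
    have hlu : lin K θ (u • p) = algebraMap K F u * lin K θ p := by
      rw [Units.smul_def, map_smul, Algebra.smul_def]
    rw [hlu] at hk
    have hk0 : algebraMap K F k ≠ 0 := by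
      rw [hk]
      positivity
    refine ⟨w', hw', 1 / (k * (u : K) ^ 2), hw0, ?_⟩
    rw [map_div₀, map_mul, map_pow, map_one, hk]
    field_simp
  obtain ⟨g, hg⟩ := hγ
  have hρ' : ρ = algebraMap K F g * (μ * κ) * ν := by
    rw [hg]
    field_simp
  refine ⟨B, ν, g, hν, ?_, hρ', hB⟩
  rintro rfl
  simp [hρ'] at hρ

theorem smul_lin_eq {W : Submodule K F} {μ ρ κ ν : F} {g : K} (hν : ν ≠ 0) (hg : g ≠ 0)
    (hW : W = κ • LinearMap.range (lin K θ)) (hρ : ρ = algebraMap K F g * (μ * κ) * ν)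
    {B : GL (Fin 2) K} (hB : ∀ y, lin K φ (B • y) = ν * lin K θ y) (x : ℙ K (Fin 2 → K)) :
    (μ / lin K θ x.rep ^ 2) • W = (ρ / lin K φ (B • x).rep ^ 2) • LinearMap.range (lin K φ) := by
  have hrange : LinearMap.range (lin K φ) = ν • LinearMap.range (lin K θ) := by
    ext z
    rw [Submodule.mem_smul_pointwise_iff_exists]
    constructor
    · rintro ⟨y, rfl⟩
      refine ⟨_, ⟨B⁻¹ • y, rfl⟩, ?_⟩
      rw [smul_eq_mul, ← hB, smul_inv_smul]
    · rintro ⟨_, ⟨y, rfl⟩, rfl⟩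
      exact ⟨B • y, hB y⟩
  have hBx : B • x.rep ≠ 0 := (smul_ne_zero_iff_ne B).2 x.rep_nonzero
  have hx : B • x = Projectivization.mk K (B • x.rep) hBx := by
    conv_lhs => rw [← x.mk_rep]
    rfl
  obtain ⟨u, hu⟩ := Projectivization.exists_smul_eq_mk_rep K (B • x.rep) hBx
  rw [hx, ← hu, Units.smul_def, map_smul, hB, hrange, hW, hρ, smul_smul, smul_smul]
  have he := lin_ne_zero h3 hθ x.rep_nonzero
  have hu0 : algebraMap K F u ≠ 0 := (map_ne_zero _).2 u.ne_zero
  -- The two multipliers differ by a factor from `K`, which comes from `g` and from the choice of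
  -- representatives and does not change the subspace.
  have hkey : algebraMap K F g * (μ * κ) * ν / ((u : K) • (ν * lin K θ x.rep)) ^ 2 * ν =
      algebraMap K F (g / (u : K) ^ 2) * (μ / lin K θ x.rep ^ 2 * κ) := by
    rw [Algebra.smul_def, map_div₀, map_pow]
    field_simp
  rw [hkey]
  have hc0 : g / (u : K) ^ 2 ≠ 0 := div_ne_zero hg (pow_ne_zero 2 u.ne_zero)
  ext z
  simp only [Submodule.mem_smul_pointwise_iff_exists]
  constructor
  · rintro ⟨v, hv, rfl⟩
    refine ⟨(g / (u : K) ^ 2)⁻¹ • v, Submodule.smul_mem _ _ hv, ?_⟩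
    rw [mul_smul, Algebra.smul_def _ v, map_inv₀]
    simp only [smul_eq_mul]
    have := (map_ne_zero (algebraMap K F)).2 hc0
    field_simp
  · rintro ⟨v, hv, rfl⟩
    refine ⟨(g / (u : K) ^ 2) • v, Submodule.smul_mem _ _ hv, ?_⟩
    rw [mul_smul, Algebra.smul_def _ v]
    simp only [smul_eq_mul]
    ring

end Matching

/-! ### Ruled surfaces through the transversals. -/

section Ruled

variable {K F : Type*} [Field K] [Finite K] [Field F] [Algebra K F]
  {b : Module.Basis (Fin 3) K F} {l t : F × F × F} {A : V7 K} {l₀ l₁ θ ρ φ : F}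
  {N : NormalCurve K (V7 K) 3} {C : NormalCurve K (V7 K) 2}

theorem det_ne_zero_of_mk_ne (hl : l ∈ lineInf F) (ht : t ∈ lineInf F) (hl0 : l ≠ 0) (ht0 : t ≠ 0)
    (hne : Projectivization.mk F l hl0 ≠ Projectivization.mk F t ht0) :
    l.1 * t.2.1 - l.2.1 * t.1 ≠ 0 := by
  intro h
  rw [mem_lineInf] at hl ht
  have h1 := coeffs_eq_zero_of_mk_ne hl0 ht0 hne (a := t.2.1) (c := -l.2.1) (by
    refine Prod.ext ?_ (Prod.ext ?_ ?_)
    · change t.2.1 * l.1 + -l.2.1 * t.1 = 0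
      linear_combination h
    · change t.2.1 * l.2.1 + -l.2.1 * t.2.1 = 0
      ring
    · simp [hl, ht])
  have h2 := coeffs_eq_zero_of_mk_ne hl0 ht0 hne (a := t.1) (c := -l.1) (by
    refine Prod.ext ?_ (Prod.ext ?_ ?_)
    · change t.1 * l.1 + -l.1 * t.1 = 0
      ring
    · change t.1 * l.2.1 + -l.1 * t.2.1 = 0
      linear_combination -h
    · simp [hl, ht])
  exact ht0 (Prod.ext h2.1 (Prod.ext h1.1 ht))

omit [Finite K] in
theorem tri_coeffs_eq_zero (hdet : l.1 * t.2.1 - l.2.1 * t.1 ≠ 0) (τ : F →ₐ[K] F) {a c : F}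
    (h : a • tri τ l + c • tri τ t = 0) : a = 0 ∧ c = 0 := by
  have hτ : τ l.1 * τ t.2.1 - τ l.2.1 * τ t.1 ≠ 0 := by
    rw [← map_mul, ← map_mul, ← map_sub]
    exact (map_ne_zero τ).2 hdet
  have h1 : a * τ l.1 + c * τ t.1 = 0 := congrArg Prod.fst h
  have h2 : a * τ l.2.1 + c * τ t.2.1 = 0 := congrArg (fun x => x.2.1) h
  constructor
  · apply mul_left_cancel₀ hτ
    linear_combination τ t.2.1 * h1 - τ t.1 * h2
  · apply mul_left_cancel₀ hτ
    linear_combination τ l.1 * h2 - τ l.2.1 * h1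

omit [Finite K] in
theorem exists_tri_coeffs (hl : l ∈ lineInf F) (ht : t ∈ lineInf F)
    (hdet : l.1 * t.2.1 - l.2.1 * t.1 ≠ 0) (τ : F →ₐ[K] F) {x : F × F × F} (hx : x ∈ lineInf F) :
    ∃ a c : F, x = a • tri τ l + c • tri τ t := by
  have hτ : τ l.1 * τ t.2.1 - τ l.2.1 * τ t.1 ≠ 0 := by
    rw [← map_mul, ← map_mul, ← map_sub]
    exact (map_ne_zero τ).2 hdet
  rw [mem_lineInf] at hl ht hx
  refine ⟨(x.1 * τ t.2.1 - x.2.1 * τ t.1) / (τ l.1 * τ t.2.1 - τ l.2.1 * τ t.1),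
    (x.2.1 * τ l.1 - x.1 * τ l.2.1) / (τ l.1 * τ t.2.1 - τ l.2.1 * τ t.1), ?_⟩
  refine Prod.ext ?_ (Prod.ext ?_ ?_)
  · simp only [tri, Prod.fst_add, Prod.smul_fst, smul_eq_mul]
    rw [div_mul_eq_mul_div, div_mul_eq_mul_div, ← add_div, eq_div_iff hτ]
    ring
  · simp only [tri, Prod.fst_add, Prod.snd_add, Prod.smul_fst, Prod.smul_snd, smul_eq_mul]
    rw [div_mul_eq_mul_div, div_mul_eq_mul_div, ← add_div, eq_div_iff hτ]
    ring
  · simp [tri, hl, ht, hx]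

theorem IsCubicForm.vec_mem_transversal (hl : l ∈ lineInf F) (hN : IsCubicForm b l A l₀ l₁ θ N)
    (τ : F →ₐ[K] F) : (N.extend b).vec ![τ θ, 1] ∈ transversal b τ := by
  have h3 := finrank_eq_three b
  refine mem_transversal.2 ⟨?_, ?_⟩ <;> rw [hN.th_vec hl]
  · simp [AlgHom.mul_apply, map_frob, frob_frob_frob h3]
  · simp [AlgHom.mul_apply, map_frob, frob_frob_frob h3]

/-- The ruled surface defined by `B` contains the transversals exactly if `B` maps the parameter
`θ` of the point of the cubic on a transversal to the parameter `φ` of that of the conic. -/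
theorem ruledSurfaceContainsTransversals_iff (hl : l ∈ lineInf F) (ht : t ∈ lineInf F)
    (hdet : l.1 * t.2.1 - l.2.1 * t.1 ≠ 0) (hA : A.2.2 ≠ 0)
    (hθ : θ ∉ Set.range (algebraMap K F)) (hφ : φ ∉ Set.range (algebraMap K F))
    (hμ : l₀ * θ + l₁ ≠ 0) (hρ : ρ ≠ 0) (hN : IsCubicForm b l A l₀ l₁ θ N)
    (hC : IsConicForm b t ρ φ C) (B : GL (Fin 2) K) :
    RuledSurfaceContainsTransversals b N C B ↔
      algebraMap K F (B.1 0 0) * θ + algebraMap K F (B.1 0 1) =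
        φ * (algebraMap K F (B.1 1 0) * θ + algebraMap K F (B.1 1 1)) := by
  have h3 := finrank_eq_three b
  constructor
  · intro h
    -- One test point suffices. Its components along `l` and `t` are both one, so neither end of its
    -- generator can drop out.
    obtain ⟨v, hv, hvlt⟩ := exists_mem_transversal (b := b) 1
      (Submodule.add_mem (lineInf F) hl ht)
    have hv0 : v ≠ 0 := by
      rintro rfl
      rw [map_zero] at hvlt
      have := tri_coeffs_eq_zero hdet (1 : F →ₐ[K] F) (a := 1) (c := 1)
        (by simpa [tri] using hvlt.symm)
      exact one_ne_zero this.1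
    obtain ⟨x, hx⟩ := h _ (isTransversal_transversal_one b) (Projectivization.mk F v hv0) (by
      rwa [Projectivization.submodule_mk, Submodule.span_singleton_le_iff_mem])
    induction x using Projectivization.ind with | _ p hp =>
    rw [generator, Projectivization.smul_mk, NormalCurve.point_mk, NormalCurve.point_mk,
      Projectivization.submodule_mk, Projectivization.submodule_mk, Projectivization.submodule_mk,
      Submodule.span_singleton_le_iff_mem, Submodule.mem_sup] at hx
    obtain ⟨_, hy, _, hz, e⟩ := hx
    obtain ⟨a, rfl⟩ := Submodule.mem_span_singleton.1 hy
    obtain ⟨c, rfl⟩ := Submodule.mem_span_singleton.1 hz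
    set q := Matrix.GeneralLinearGroup.map (algebraMap K F) B • p with hq
    have e0 := congrArg (th b 1) e
    have e1 := (congrArg (th b (frob K F * 1)) e).trans (mem_transversal.1 hv).1
    rw [map_add, map_smul, map_smul, hN.th_vec hl, hC.th_vec ht, smul_add, smul_smul, smul_smul,
      smul_smul] at e0 e1
    simp only [mul_one, AlgHom.one_apply] at e0 e1
    have hAτ : ∀ τ : F →ₐ[K] F, (tri τ (sigmaInv b A)).2.2 ≠ 0 := fun τ => by
      simpa [tri, sigmaInv_snd_snd] using hA
    rw [mem_lineInf] at hl ht
    have z0 := congrArg (fun v => v.2.2) e0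
    have z1 := congrArg (fun v => v.2.2) e1
    simp only [Prod.snd_add, Prod.smul_snd, smul_eq_mul, tri, hl, ht, map_zero, mul_zero,
      zero_add, add_zero, hvlt, Prod.snd_zero] at z0 z1
    replace z0 := (mul_eq_zero.1 z0).resolve_right (hAτ 1)
    replace z1 := (mul_eq_zero.1 z1).resolve_right (hAτ (frob K F))
    rw [z0, zero_smul, add_zero, hvlt] at e0
    rw [z1, zero_smul, add_zero] at e1
    have hlt : l + t = (1 : F) • tri (1 : F →ₐ[K] F) l + (1 : F) • tri (1 : F →ₐ[K] F) t := by
      simp [tri]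
    rw [hlt, ← sub_eq_zero, add_sub_add_comm, ← sub_smul, ← sub_smul] at e0
    have e0' := tri_coeffs_eq_zero hdet (1 : F →ₐ[K] F) e0
    have e1' := tri_coeffs_eq_zero hdet _ e1
    have a0 := sub_eq_zero.1 e0'.1
    have c0 := sub_eq_zero.1 e0'.2
    have a1 : a ≠ 0 := left_ne_zero_of_mul_eq_one a0
    have c1 : c ≠ 0 := left_ne_zero_of_mul_eq_one c0
    have Λ := right_ne_zero_of_mul_eq_one a0
    have Γ := right_ne_zero_of_mul_eq_one c0
    -- The last coordinate makes the norm form vanish at `p`, while the component along `l` keeps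
    -- the factors of `θ^q` and `θ^{q²}` nonzero.
    have hpθ : p 0 - θ * p 1 = 0 := by
      have := (mul_eq_zero.1 z0).resolve_left a1
      rw [mul_assoc] at this
      exact (mul_eq_zero.1 this).resolve_right (left_ne_zero_of_mul Λ)
    -- The conjugate coordinate map vanishes at the test point, so `φ^{q²}` or `φ` is a root at `q`.
    -- The component along `t` excludes `φ^{q²}`.
    have hqφ : q 0 - φ * q 1 = 0 := by
      have h1 := (mul_eq_zero.1 e1'.2).resolve_left c1
      have h2 := (mul_eq_zero.1 h1).resolve_left ((map_ne_zero _).2 hρ)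
      rw [frob_frob_frob h3] at h2
      exact (mul_eq_zero.1 h2).resolve_left (right_ne_zero_of_mul (right_ne_zero_of_mul Γ))
    have hp1 : p 1 ≠ 0 := by
      intro h1
      rw [h1, mul_zero, sub_zero] at hpθ
      exact hp (funext fun i => by fin_cases i <;> assumption)
    rw [hq, map_gl_smul_apply, map_gl_smul_apply] at hqφ
    apply mul_right_cancel₀ hp1
    linear_combination hqφ + (φ * algebraMap K F (B.1 1 0) - algebraMap K F (B.1 0 0)) * hpθ
  · intro hB g hg P hP
    obtain ⟨τ, rfl⟩ := hg.exists_eq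
    induction P using Projectivization.ind with | _ v hv0 =>
    rw [Projectivization.submodule_mk, Submodule.span_singleton_le_iff_mem] at hP
    refine ⟨Projectivization.mk F ![τ θ, 1] (vec_ne_zero_of_pair _), ?_⟩
    obtain ⟨α, β, hαβ⟩ := exists_tri_coeffs hl ht hdet τ
      (th_mem_lineInf (b := b) τ (snd_snd_of_mem_transversal hP))
    have hτB := congrArg τ hB
    simp only [map_add, map_mul, AlgHom.commutes] at hτB
    rw [generator, Projectivization.smul_mk, NormalCurve.point_mk, NormalCurve.point_mk,
      Projectivization.submodule_mk, Projectivization.submodule_mk, Projectivization.submodule_mk,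
      Submodule.span_singleton_le_iff_mem]
    set q := Matrix.GeneralLinearGroup.map (algebraMap K F) B • (![τ θ, 1] : Fin 2 → F) with hq
    have hq0 : q ≠ 0 := (smul_ne_zero_iff_ne _).2 (vec_ne_zero_of_pair _)
    have hqφ : q 0 = τ φ * q 1 := by
      rw [hq, map_gl_smul_apply, map_gl_smul_apply]
      simpa using hτB
    have hq1 : q 1 ≠ 0 := by
      intro h1
      rw [h1, mul_zero] at hqφ
      exact hq0 (funext fun i => by fin_cases i <;> assumption)
    have hqe : q = q 1 • ![τ φ, 1] := by
      funext i
      fin_cases i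
      · simp [hqφ, mul_comm]
      · simp
    have hΛ := hN.th_vec hl τ ![τ θ, 1]
    have hΓ := hC.th_vec ht τ ![τ φ, 1]
    simp only [Matrix.cons_val, mul_one, sub_self, zero_mul, zero_smul, add_zero] at hΛ hΓ
    have hθτ := algHom_notMem_range τ hθ
    have hφτ := algHom_notMem_range τ hφ
    have hμτ : τ l₀ * τ θ + τ l₁ ≠ 0 := by
      rw [← map_mul, ← map_add]
      exact (map_ne_zero τ).2 hμ
    have hρτ : τ ρ ≠ 0 := (map_ne_zero τ).2 hρ
    simp only [map_frob] at hΛ hΓ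
    have n1 := sub_ne_zero.2 (frob_ne h3 hθτ).symm
    have n2 := sub_ne_zero.2 (frob_frob_ne h3 hθτ).symm
    have n3 := sub_ne_zero.2 (frob_ne h3 hφτ).symm
    have n4 := sub_ne_zero.2 (frob_frob_ne h3 hφτ).symm
    set Λ := (τ θ - frob K F (τ θ)) * (τ θ - frob K F (frob K F (τ θ))) *
      (τ l₀ * τ θ + τ l₁) with hΛdef
    set Γ := τ ρ * ((τ φ - frob K F (τ φ)) * (τ φ - frob K F (frob K F (τ φ)))) with hΓdef
    have hΛ0 : Λ ≠ 0 := mul_ne_zero (mul_ne_zero n1 n2) hμτ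
    have hΓ0 : Γ ≠ 0 := mul_ne_zero hρτ (mul_ne_zero n3 n4)
    -- The points of the cubic and the conic on this transversal have coordinates `Λ` along `l` and
    -- `Γ` along `t`. The factor `q 1 ^ 2` appears because the conic is quadratic in the parameter.
    have hv : v = (α / Λ) • (N.extend b).vec ![τ θ, 1] +
        (β / (q 1 ^ 2 * Γ)) • (C.extend b).vec q := by
      have hvq : (C.extend b).vec q = q 1 ^ 2 • (C.extend b).vec ![τ φ, 1] := by
        conv_lhs => rw [hqe]
        rw [NormalCurve.vec_smul]
      rw [hvq, smul_smul]
      refine eq_of_mem_transversal hP (Submodule.add_mem _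
        (Submodule.smul_mem _ _ (hN.vec_mem_transversal hl τ))
        (Submodule.smul_mem _ _ (hC.vec_mem_transversal ht τ))) ?_
      rw [hαβ, map_add, map_smul, map_smul, hΛ, hΓ, smul_smul, smul_smul,
        div_mul_cancel₀ _ hΛ0]
      congr 2
      field_simp
    rw [hv]
    exact Submodule.add_mem_sup (Submodule.smul_mem _ _ (Submodule.mem_span_singleton_self _))
      (Submodule.smul_mem _ _ (Submodule.mem_span_singleton_self _))

/-- `B` sends `θ` to `φ`, so another matrix doing the same differs from it by one that fixes `θ`.
The fixed point equation is quadratic over `K`, hence trivial at `θ`, and that matrix is scalar. -/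
theorem mk_eq_mk_iff_fixes (h3 : Module.finrank K F = 3) (hθ : θ ∉ Set.range (algebraMap K F))
    {ν : F} (hν : ν ≠ 0) {B : GL (Fin 2) K} (hB : ∀ y, lin K φ (B • y) = ν * lin K θ y)
    (B' : GL (Fin 2) K) :
    algebraMap K F (B'.1 0 0) * θ + algebraMap K F (B'.1 0 1) =
        φ * (algebraMap K F (B'.1 1 0) * θ + algebraMap K F (B'.1 1 1)) ↔
      (Matrix.ProjGenLinGroup.mk B' : PGL(2, K)) = Matrix.ProjGenLinGroup.mk B := by
  obtain ⟨h0, h1⟩ := lin_gl_coeffs hB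
  constructor
  · intro h
    obtain ⟨G, rfl⟩ : ∃ G, B' = B * G := ⟨B⁻¹ * B', by group⟩
    simp only [Units.val_mul, Matrix.mul_apply, Fin.sum_univ_two, map_add, map_mul] at h
    have hG := quadratic_coeffs_eq_zero h3 hθ (a := G.1 0 1) (b := G.1 0 0 - G.1 1 1)
      (c := -G.1 1 0) (by
        apply mul_left_cancel₀ hν
        rw [map_sub, map_neg]
        linear_combination h - (algebraMap K F (G.1 0 0) * θ + algebraMap K F (G.1 0 1)) * h0 -
          (algebraMap K F (G.1 1 0) * θ + algebraMap K F (G.1 1 1)) * h1)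
    obtain ⟨g01, g00, g10⟩ := hG
    replace g10 := neg_eq_zero.1 g10
    replace g00 := sub_eq_zero.1 g00
    have hdet := G.det.ne_zero
    have hdet' : G.1 0 0 ≠ 0 := by
      intro h
      apply hdet
      change G.1.det = 0
      rw [Matrix.det_fin_two, h, g01]
      ring
    rw [eq_comm, Matrix.ProjGenLinGroup.mk_eq_mk_iff]
    refine ⟨Units.mk0 _ hdet', ?_⟩
    congr 1
    ext i j
    fin_cases i <;> fin_cases j
    · simp
    · simpa using g01.symm
    · simpa using g10.symm
    · simpa using g00
  · intro h
    rw [eq_comm, Matrix.ProjGenLinGroup.mk_eq_mk_iff] at h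
    obtain ⟨u, rfl⟩ := h
    simp only [Units.val_mul, Matrix.mul_apply, Fin.sum_univ_two, map_add, map_mul]
    simp
    linear_combination algebraMap K F u * (θ * h0 + h1)

/-- Substituting `B` into `ρ f^q f^{q²}` produces `g` times the norm of `ν` times `κ e^q e^{q²}`.
The extra factor is in `K`, so it is the same in all conjugate coordinates and the points agree. -/
theorem extend_point_smul_eq {C₀ : NormalCurve K (V7 K) 2} {κ ν : F} {g : K}
    (ht : t ∈ lineInf F) (hρ : ρ = algebraMap K F g * κ * ν)
    (hC : IsConicForm b t ρ φ C) (hC₀ : IsConicForm b t κ θ C₀) {B : GL (Fin 2) K}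
    (hB : ∀ y, lin K φ (B • y) = ν * lin K θ y) (x : ℙ F (Fin 2 → F)) :
    (C.extend b).point (Matrix.GeneralLinearGroup.map (algebraMap K F) B • x) =
      (C₀.extend b).point x := by
  have h3 := finrank_eq_three b
  obtain ⟨k, hk⟩ := norm_mem_range h3 ν
  induction x using Projectivization.ind with | _ p hp =>
  rw [Projectivization.smul_mk, NormalCurve.point_mk, NormalCurve.point_mk,
    Projectivization.mk_eq_mk_iff']
  refine ⟨algebraMap K F (g * k), ?_⟩
  rw [← sub_eq_zero]
  have hkey : ∀ τ : F →ₐ[K] F, th b τ (algebraMap K F (g * k) • (C₀.extend b).vec p -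
      (C.extend b).vec (Matrix.GeneralLinearGroup.map (algebraMap K F) B • p)) = 0 := by
    intro τ
    have e1 := map_gl_smul_sub hB (τ * frob K F) p
    have e2 := map_gl_smul_sub hB (τ * (frob K F * frob K F)) p
    simp only [AlgHom.mul_apply] at e1 e2
    have hk' := congrArg τ hk
    simp only [map_mul, AlgHom.commutes] at hk'
    rw [map_sub, map_smul, hC.th_vec ht, hC₀.th_vec ht, e1, e2, hρ, smul_smul, ← sub_smul]
    simp only [map_mul, AlgHom.commutes, hk']
    rw [show ∀ a : F, a = 0 → a • tri τ t = 0 from fun a h => by rw [h, zero_smul]]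
    ring
  exact th_eq_zero b 1 (hkey _) (hkey _) (hkey _)

end Ruled

theorem projGenLinGroup_mk_smul {R : Type*} [Field R] (B : GL (Fin 2) R) (x : ℙ R (Fin 2 → R)) :
    (Matrix.ProjGenLinGroup.mk B : PGL(2, R)) • x = B • x := rfl

/-! ### Shadow points, cover lines and constructed conics in normal form. -/

section Construction

variable {K F : Type*} [Field K] [Finite K] [Field F] [Algebra K F]
  {b : Module.Basis (Fin 3) K F} {l t : F × F × F} {A : V7 K} {l₀ l₁ θ : F}
  {N : NormalCurve K (V7 K) 3} {hl0 : l ≠ 0} {ht0 : t ≠ 0}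
  {S : Set (ℙ F (F × F × F))} {W : Submodule K F}

theorem IsCubicForm.isShadowPoint_iff (hl : l ∈ lineInf F) (hA : A.2.2 ≠ 0)
    (hθ : θ ∉ Set.range (algebraMap K F)) (hN : IsCubicForm b l A l₀ l₁ θ N)
    (x : ℙ K (Fin 2 → K)) (D : ℙ K (V7 K)) :
    IsShadowPoint b (Projectivization.mk F l hl0) N x D ↔
      D.submodule = K ∙ emb b l ((l₀ * θ + l₁) / lin K θ x.rep ^ 2) := by
  rw [IsShadowPoint, hN.tangentLine_inf_bb hl hl0 hA hθ]

theorem IsCubicForm.shadow_ne_zero (b : Module.Basis (Fin 3) K F)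
    (hθ : θ ∉ Set.range (algebraMap K F)) (hμ : l₀ * θ + l₁ ≠ 0) (x : ℙ K (Fin 2 → K)) :
    (l₀ * θ + l₁) / lin K θ x.rep ^ 2 ≠ 0 :=
  div_ne_zero hμ (pow_ne_zero 2 (lin_ne_zero (finrank_eq_three b) hθ x.rep_nonzero))

variable (hl : l ∈ lineInf F) (ht : t ∈ lineInf F)
  (hne : Projectivization.mk F l hl0 ≠ Projectivization.mk F t ht0)
  (hW : Module.finrank K W = 2)
  (hS : ∀ X, X ∈ S ↔ X = Projectivization.mk F t ht0 ∨ ∃ w ∈ W, X.submodule = F ∙ (l + w • t))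
  (hA : A.2.2 ≠ 0) (hθ : θ ∉ Set.range (algebraMap K F)) (hμ : l₀ * θ + l₁ ≠ 0)
  (hN : IsCubicForm b l A l₀ l₁ θ N)
include hl ht hne hW hS

omit [Finite K] in
theorem isCoverPlane_and_le_iff {d : F} (hd : d ≠ 0) {D : ℙ K (V7 K)}
    (hD : D.submodule = K ∙ emb b l d) (π : Submodule K (V7 K)) :
    IsCoverPlane b S (Projectivization.mk F t ht0) π ∧ D.submodule ≤ π ↔
      π = coverPlane b l t W d := by
  rw [hD, Submodule.span_singleton_le_iff_mem]
  constructor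
  · rintro ⟨hπ, hdπ⟩
    exact hπ.eq_coverPlane hl ht hl0 ht0 hne hW hS hd hdπ
  · rintro rfl
    exact ⟨isCoverPlane_coverPlane hl ht hl0 ht0 hne hW hS hd,
      Submodule.mem_sup_left (Submodule.mem_span_singleton_self _)⟩

omit [Finite K] in
theorem isCoverLine_iff {d : F} (hd : d ≠ 0) {D : ℙ K (V7 K)}
    (hD : D.submodule = K ∙ emb b l d) (s : Submodule K (V7 K)) :
    IsCoverLine b S (Projectivization.mk F t ht0) D s ↔ s = (d • W).map (emb b t) := by
  rw [← span_emb_sup_inf_bb hl ht hl0 ht0 hne hd]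
  constructor
  · rintro ⟨π, hπ, hDπ, rfl⟩
    rw [(isCoverPlane_and_le_iff hl ht hne hW hS hd hD π).1 ⟨hπ, hDπ⟩, coverPlane]
  · rintro rfl
    obtain ⟨h1, h2⟩ := (isCoverPlane_and_le_iff hl ht hne hW hS hd hD _).2 rfl
    exact ⟨_, h1, h2, rfl⟩

include hA hθ hμ hN

theorem shadow_and_coverLine_iff (x : ℙ K (Fin 2 → K)) (s : Submodule K (V7 K)) :
    (∃ D, IsShadowPoint b (Projectivization.mk F l hl0) N x D ∧
      IsCoverLine b S (Projectivization.mk F t ht0) D s) ↔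
      s = (((l₀ * θ + l₁) / lin K θ x.rep ^ 2) • W).map (emb b t) := by
  have hd := IsCubicForm.shadow_ne_zero b hθ hμ x
  constructor
  · rintro ⟨D, hD, hs⟩
    exact (isCoverLine_iff hl ht hne hW hS hd ((hN.isShadowPoint_iff hl hA hθ x D).1 hD) s).1 hs
  · intro hs
    have h0 : emb b l ((l₀ * θ + l₁) / lin K θ x.rep ^ 2) ≠ 0 := fun h =>
      hd (emb_injective hl hl0 (h.trans (map_zero _).symm))
    have hD := Projectivization.submodule_mk (K := K) _ h0
    exact ⟨_, (hN.isShadowPoint_iff hl hA hθ x _).2 hD,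
      (isCoverLine_iff hl ht hne hW hS hd hD s).2 hs⟩

theorem isConstructedConic_iff (C : NormalCurve K (V7 K) 2) :
    IsConstructedConic b S (Projectivization.mk F t ht0) (Projectivization.mk F l hl0) N C ↔
      IsSpecialConic b (Projectivization.mk F t ht0) C ∧ ∀ x : ℙ K (Fin 2 → K), ∃ y,
        (((l₀ * θ + l₁) / lin K θ x.rep ^ 2) • W).map (emb b t) = C.tangentLine y := by
  have key := shadow_and_coverLine_iff hl ht hne hW hS hA hθ hμ hN
  refine and_congr_right fun _ => ⟨fun h x => ?_, fun h x D s hD hs => ?_⟩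
  · obtain ⟨D, hD, hs⟩ := (key x _).2 rfl
    exact h x D _ hD hs
  · rw [(key x s).1 ⟨D, hD, hs⟩]
    exact h x

theorem phiRel_iff {C : NormalCurve K (V7 K) 2} {B : GL (Fin 2) K}
    (hB : ∀ x : ℙ K (Fin 2 → K), (((l₀ * θ + l₁) / lin K θ x.rep ^ 2) • W).map (emb b t) =
      C.tangentLine (B • x)) (P Q : ℙ K (V7 K)) :
    PhiRel b S (Projectivization.mk F t ht0) (Projectivization.mk F l hl0) N C P Q ↔
      ∃ x, P = N.point x ∧ Q = C.point (B • x) := by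
  have key := shadow_and_coverLine_iff hl ht hne hW hS hA hθ hμ hN
  constructor
  · rintro ⟨x, D, s, rfl, hD, hs, ⟨y, rfl⟩, hQ⟩
    refine ⟨x, rfl, ?_⟩
    rw [(key x s).1 ⟨D, hD, hs⟩, hB, NormalCurve.point_eq_mk_rep, Projectivization.submodule_mk,
      Submodule.span_singleton_le_iff_mem] at hQ
    rw [NormalCurve.eq_of_vec_mem_tangentLine hQ]
  · rintro ⟨x, rfl, rfl⟩
    obtain ⟨D, hD, hs⟩ := (key x _).2 rfl
    refine ⟨x, D, _, rfl, hD, hs, ⟨_, rfl⟩, ?_⟩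
    rw [hB, NormalCurve.point_eq_mk_rep, Projectivization.submodule_mk,
      Submodule.span_singleton_le_iff_mem]
    exact NormalCurve.vec_mem_tangentLine _ _

/-- Every conic constructed from the cubic is, up to a change of parameter given by some `B`, the
conic with parameter `θ`, and `B` matches the points of the cubic with the tangents. -/
theorem IsConstructedConic.exists_parameters {κ : F} (hκ : κ ≠ 0)
    (hWκ : W = κ • LinearMap.range (lin K θ)) {C : NormalCurve K (V7 K) 2}
    (hC : IsConstructedConic b S (Projectivization.mk F t ht0) (Projectivization.mk F l hl0) N C) :
    ∃ (ρ φ ν : F) (g : K) (B : GL (Fin 2) K), ρ ≠ 0 ∧ φ ∉ Set.range (algebraMap K F) ∧ ν ≠ 0 ∧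
      IsConicForm b t ρ φ C ∧ ρ = algebraMap K F g * ((l₀ * θ + l₁) * κ) * ν ∧
      (∀ y, lin K φ (B • y) = ν * lin K θ y) ∧
      ∀ x : ℙ K (Fin 2 → K), (((l₀ * θ + l₁) / lin K θ x.rep ^ 2) • W).map (emb b t) =
        C.tangentLine (B • x) := by
  have h3 := finrank_eq_three b
  obtain ⟨hsp, htan⟩ := (isConstructedConic_iff hl ht hne hW hS hA hθ hμ hN C).1 hC
  obtain ⟨ρ, φ, hρ, hφ, hCf⟩ := hsp.exists_isConicForm ht ht0
  obtain ⟨B, ν, g, hν, hg, hρg, hB⟩ := exists_matching h3 hθ hφ hμ hρ hκ hWκ fun x => by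
    obtain ⟨y, hy⟩ := htan x
    rw [hCf.tangentLine_eq hφ] at hy
    exact ⟨y, Submodule.map_injective_of_injective (emb_injective ht ht0) hy⟩
  refine ⟨ρ, φ, ν, g, B, hρ, hφ, hν, hCf, hρg, hB, fun x => ?_⟩
  rw [hCf.tangentLine_eq hφ, smul_lin_eq h3 hθ hν hg hWκ hρg hB]

end Construction

end TangentSplash

/-! ### The main theorem. -/

theorem theorem5p8 {K F : Type*} [Field K] [Finite K] [Field F] [Algebra K F]
    (b : Module.Basis (Fin 3) K F)
    (S : Set (ℙ F (F × F × F))) (T : ℙ F (F × F × F)) (hS : IsTangentSplash K S T)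
    (L : ℙ F (F × F × F)) (hL : L ∈ S) (hLT : L ≠ T)
    (N : NormalCurve K (V7 K) 3) (hN : IsSpecialTwistedCubic b L N) :
    -- each tangent of `N` meets `[L]` in one point, and there is one cover plane through it
    (∀ x, ∃! D, IsShadowPoint b L N x D) ∧
    (∀ x D, IsShadowPoint b L N x D → ∃! π, IsCoverPlane b S T π ∧ D.submodule ≤ π) ∧
    -- the special conic constructed from `N` exists and is unique
    (∃ C, IsConstructedConic b S T L N C) ∧
    (∀ C C', IsConstructedConic b S T L N C → IsConstructedConic b S T L N C' →
      (C.extend b).points = (C'.extend b).points) ∧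
    ∀ C, IsConstructedConic b S T L N C →
      -- the construction is a well-defined map `φ` from `N` to `C`
      ∃ φ : N.points → C.points,
        (∀ (P : N.points) (Q : C.points), PhiRel b S T L N C P Q ↔ φ P = Q) ∧
        -- exactly one projectivity `η` gives a ruled surface containing the transversals
        ∃ η : PGL(2, K),
          (∀ A : GL (Fin 2) K, RuledSurfaceContainsTransversals b N C A ↔
            Matrix.ProjGenLinGroup.mk A = η) ∧
          -- `φ` is this projectivity
          (∀ (P : N.points) x, (P : ℙ K (V7 K)) = N.point x →
            (φ P : ℙ K (V7 K)) = C.point (η • x)) ∧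
          -- the lines `Nᵢ Cᵢ` are the generators of the surface
          (∀ A : GL (Fin 2) K, RuledSurfaceContainsTransversals b N C A →
            Set.range (generator N C A) =
              {ℓ | ∃ P : N.points, ℓ = (P : ℙ K (V7 K)).submodule ⊔
                (φ P : ℙ K (V7 K)).submodule}) := by
  have h3 := finrank_eq_three b
  obtain ⟨l, t, hl0, ht0, W, rfl, rfl, hl, ht, hW, hS'⟩ := hS.exists_coordinates hL hLT
  obtain ⟨A, l₀, l₁, θ, hA, hθ, hμ, hNf⟩ := hN.exists_isCubicForm hl hl0
  obtain ⟨κ, hκ, hWκ⟩ := exists_smul_eq h3 (finrank_range_lin h3 hθ) hW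
  have hd := IsCubicForm.shadow_ne_zero b hθ hμ
  -- With root `θ` and factor `(l₀ θ + l₁) κ`, the tangent at the parameter `x` is the line obtained
  -- from the point of the cubic with the same parameter.
  obtain ⟨C₀, hC₀⟩ := exists_isConicForm (b := b) hθ (mul_ne_zero hμ hκ) ht ht0
  have hpoints : ∀ C, IsConstructedConic b S (Projectivization.mk F t ht0)
      (Projectivization.mk F l hl0) N C → (C.extend b).points = (C₀.extend b).points := by
    intro C hC
    obtain ⟨ρ, φ, ν, g, B, -, -, -, hCf, hρg, hB, -⟩ :=
      hC.exists_parameters hl ht hLT hW hS' hA hθ hμ hNf hκ hWκ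
    have key := extend_point_smul_eq ht hρg hCf hC₀ hB
    ext P
    constructor
    · rintro ⟨x, rfl⟩
      refine ⟨(Matrix.GeneralLinearGroup.map (algebraMap K F) B)⁻¹ • x, ?_⟩
      rw [← key, smul_inv_smul]
    · rintro ⟨x, rfl⟩
      exact ⟨_, key x⟩
  refine ⟨fun x => ?_, fun x D hD => ?_, ⟨C₀, ?_⟩,
    fun C C' hC hC' => (hpoints C hC).trans (hpoints C' hC').symm, fun C hC => ?_⟩
  · have h0 : emb b l ((l₀ * θ + l₁) / lin K θ x.rep ^ 2) ≠ 0 := fun h =>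
      hd x (emb_injective hl hl0 (h.trans (map_zero _).symm))
    refine ⟨Projectivization.mk K _ h0,
      (hNf.isShadowPoint_iff hl hA hθ x _).2 (Projectivization.submodule_mk _ _), fun D hD => ?_⟩
    apply Projectivization.submodule_injective
    rw [(hNf.isShadowPoint_iff hl hA hθ x D).1 hD, Projectivization.submodule_mk]
  · have key := isCoverPlane_and_le_iff hl ht hLT hW hS' (hd x)
      ((hNf.isShadowPoint_iff hl hA hθ x D).1 hD)
    exact ⟨_, (key _).2 rfl, fun π hπ => (key π).1 hπ⟩
  · refine (isConstructedConic_iff hl ht hLT hW hS' hA hθ hμ hNf C₀).2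
      ⟨hC₀.isSpecialConic ht ht0, fun x => ⟨x, ?_⟩⟩
    rw [hC₀.tangentLine_eq hθ, hWκ, smul_smul, div_mul_eq_mul_div]
  · obtain ⟨ρ, φ, ν, g, B, hρ, hφ, hν, hCf, hρg, hB, htan⟩ :=
      hC.exists_parameters hl ht hLT hW hS' hA hθ hμ hNf hκ hWκ
    -- The matrix `B` that matches the tangents also carries `θ` to `φ`. This is the reason that the
    -- two maps agree.
    have hruled : ∀ B' : GL (Fin 2) K, RuledSurfaceContainsTransversals b N C B' ↔
        (Matrix.ProjGenLinGroup.mk B' : PGL(2, K)) = Matrix.ProjGenLinGroup.mk B := fun B' =>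
      (ruledSurfaceContainsTransversals_iff hl ht (det_ne_zero_of_mk_ne hl ht hl0 ht0 hLT) hA hθ hφ
        hμ hρ hNf hCf B').trans (mk_eq_mk_iff_fixes h3 hθ hν hB B')
    have hphi := phiRel_iff hl ht hLT hW hS' hA hθ hμ hNf htan
    choose par hpar using fun P : N.points => P.2
    have hpar' : ∀ (P : N.points) x, (P : ℙ K (V7 K)) = N.point x → par P = x := fun P x hx =>
      N.point_three_injective ((hpar P).trans hx)
    refine ⟨fun P => ⟨C.point (B • par P), Set.mem_range_self _⟩, fun P Q => ?_,
      Matrix.ProjGenLinGroup.mk B, hruled, fun P x hx => ?_, fun B' hB' => ?_⟩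
    · rw [hphi, Subtype.ext_iff]
      constructor
      · rintro ⟨x, hP, hQ⟩
        change C.point (B • par P) = Q
        rw [hpar' P x hP, hQ]
      · intro h
        exact ⟨par P, (hpar P).symm, h.symm⟩
    · change C.point (B • par P) = _
      rw [hpar' P x hx, projGenLinGroup_mk_smul]
    · have hgen : ∀ x, generator N C B' x = (N.point x).submodule ⊔ (C.point (B • x)).submodule := by
        intro x
        rw [generator, ← projGenLinGroup_mk_smul, (hruled B').1 hB', projGenLinGroup_mk_smul]
      ext ℓ
      constructor
      · rintro ⟨x, rfl⟩
        refine ⟨⟨N.point x, Set.mem_range_self x⟩, ?_⟩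
        rw [hgen]
        change _ = _ ⊔ (C.point (B • par ⟨N.point x, Set.mem_range_self x⟩)).submodule
        rw [hpar' _ x rfl]
      · rintro ⟨P, rfl⟩
        exact ⟨par P, by rw [hgen, hpar P]⟩
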